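/- Let $\sigma>0$ and $\mu\in(0,1)$. For $n\ge 1$, let $X_1\le\dots\le X_n$ be the increasing reordering of $n$ i.i.d. random variables uniformly distributed on $[0,1]$, and let $\xi_1,\dots,\xi_n$ be i.i.d. real random variables, independent of the design, with $\mathbb E[e^{u\xi_i}]\le e^{\sigma^2u^2/2}$ for all $u\in\mathbb R$. For a segment $G\subseteq[0,1]$ let $\mathbb P_G$ be the law of the observations $(X_i,Y_i)_{1\le i\le n}$ where $Y_i=\mathbf 1(X_i\in G)+\xi_i$, and $\mathbb E_G$ the corresponding expectation. Let $\mathcal S=\{[a,b]:0\le a\le b\le 1\}$ and $\mathcal S(\mu)=\{G\in\mathcal S:|G|\ge\mu\}$, where $|\cdot|$ is Lebesgue measure. The two-step estimator $\tilde G_n$ is defined as follows. Let $\hat G_n$ be a maximizer over $G'\in\mathcal S$ of $\sum_{1\le i\le n,\ i\text{ even}}(2Y_i-1)\mathbf 1(X_i\in G')$, and let $\hat m_n$ be its middle point. Let $I_1^+$ (resp. $I_1^-$) be the set of odd $i\in\{1,\dots,n\}$ with $X_i\ge\hat m_n$ (resp. $X_i<\hat m_n$), and set $F_+(M)=\sum_{i\in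 I_1^+,\,i\le M}(2Y_i-1)$ and $F_-(M)=\sum_{i\in I_1^-,\,i\ge M}(2Y_i-1)$. Let $\hat M^+$ be a maximizer of $F_+$ over $I_1^+$, with $\hat M^+=n$ if $I_1^+=\emptyset$, and let $\hat M^-$ be a maximizer of $F_-$ over $I_1^-$, with $\hat M^-=1$ if $I_1^-=\emptyset$. Set $\tilde G_n=[X_{\hat M^-},X_{\hat M^+}]$. Ties between maximizers may be broken in any way. Then there exist positive constants $c_1,\dots,c_5$, depending on $\sigma$ and $\mu$ only, such that for every $n\ge1$ and all $x\ge 0$, $$\sup_{G\in\mathcal S(\mu)}\mathbb P_G\left[|\tilde G_n\triangle G|\ge\frac{x+c_1}{n}\right]\le c_2n^4e^{-c_3n}+c_4e^{-c_5\sqrt x}.$$ Consequently, for every $q>0$ there exists a positive constant $B_q$, depending on $q$, $\mu$ and $\sigma$ only, such that for every $n\ge1$, $$\sup_{G\in\mathcal S(\mu)}\mathbb E_G\left[|\tilde G_n\triangle G|^q\right]\le\frac{B_q}{n^q}.$$ -/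

import Mathlib

open MeasureTheory ProbabilityTheory Set

universe u

noncomputable section

namespace SegmentRegression

/-- The class `𝒮` of all segments `[a, b]` with `0 ≤ a ≤ b ≤ 1`. -/
def segments : Set (Set ℝ) :=
  {G | ∃ a b : ℝ, 0 ≤ a ∧ a ≤ b ∧ b ≤ 1 ∧ G = Icc a b}

/-- The class `𝒮(μ)` of all segments in `[0, 1]` of length at least `μ`. -/
def longSegments (μ : ℝ) : Set (Set ℝ) :=
  {G | G ∈ segments ∧ μ ≤ volume.real G}

/-- The Nikodym distance `|G₁ △ G₂|`. -/
def nikodymDist (G₁ G₂ : Set ℝ) : ℝ :=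
  volume.real (symmDiff G₁ G₂)

/-- The increasing reordering `u₍₁₎ ≤ … ≤ u₍ₙ₎` of `u`. -/
def reorder {n : ℕ} (u : Fin n → ℝ) : Fin n → ℝ :=
  u ∘ Tuple.sort u

/-- The labels `Yᵢ = 𝟙(Xᵢ ∈ G) + ξᵢ`. -/
def labels {n : ℕ} (G : Set ℝ) (X ξ : Fin n → ℝ) : Fin n → ℝ :=
  fun i => G.indicator 1 (X i) + ξ i

/-- The random objects of the regression model with random uniform design: a preliminary design
`U` of i.i.d. uniform variables on `[0, 1]`, and i.i.d. noise terms `ξ` that are subgaussian with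
parameter `σ` (`𝔼 exp (u ξᵢ) ≤ exp (σ² u² / 2)` for all real `u`), independent of the design. -/
structure IsRandomDesignModel {Ω : Type*} [MeasurableSpace Ω] (P : Measure Ω) (σ : ℝ) {n : ℕ}
    (U ξ : Fin n → Ω → ℝ) : Prop where
  design_uniform : ∀ i, pdf.IsUniform (U i) (Icc 0 1) P volume
  design_indep : iIndepFun U P
  noise_indep : iIndepFun ξ P
  noise_identDistrib : ∀ i j, IdentDistrib (ξ i) (ξ j) P P
  noise_subgaussian : ∀ i, HasSubgaussianMGF (ξ i) ⟨σ ^ 2, sq_nonneg σ⟩ P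
  design_indep_noise : IndepFun (fun ω i => U i ω) (fun ω i => ξ i ω) P

/-- The indices of the first subsample. An element `i` of `Fin n` stands for the index `i + 1`
in `1, …, n`, so these are the even elements of `{1, …, n}`. -/
def evenIndices (n : ℕ) : Finset (Fin n) :=
  {i | Even ((i : ℕ) + 1)}

/-- The indices of the second subsample: the odd elements of `{1, …, n}`. -/
def oddIndices (n : ℕ) : Finset (Fin n) :=
  {i | Odd ((i : ℕ) + 1)}

open scoped Classical in
/-- The least squares criterion `∑ (2 Yᵢ - 1) 𝟙(Xᵢ ∈ G')` over the subsample indexed by `I`. -/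
def lsCriterion {n : ℕ} (I : Finset (Fin n)) (X Y : Fin n → ℝ) (G' : Set ℝ) : ℝ :=
  ∑ i ∈ I with X i ∈ G', (2 * Y i - 1)

/-- `G` is a least squares estimate computed from the subsample indexed by `I`: a maximizer of the
criterion over all segments. -/
def IsLSE {n : ℕ} (I : Finset (Fin n)) (X Y : Fin n → ℝ) (G : Set ℝ) : Prop :=
  G ∈ segments ∧ ∀ G' ∈ segments, lsCriterion I X Y G' ≤ lsCriterion I X Y G

/-- The odd indices `i` with `Xᵢ ≥ m`. -/
def rightIndices {n : ℕ} (X : Fin n → ℝ) (m : ℝ) : Finset (Fin n) :=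
  {i ∈ oddIndices n | m ≤ X i}

/-- The odd indices `i` with `Xᵢ < m`. -/
def leftIndices {n : ℕ} (X : Fin n → ℝ) (m : ℝ) : Finset (Fin n) :=
  {i ∈ oddIndices n | X i < m}

/-- `F₊(M)`, the sum of `2 Yᵢ - 1` over the `i ≤ M` among the right indices. -/
def rightSum {n : ℕ} (X Y : Fin n → ℝ) (m : ℝ) (M : Fin n) : ℝ :=
  ∑ i ∈ rightIndices X m with i ≤ M, (2 * Y i - 1)

/-- `F₋(M)`, the sum of `2 Yᵢ - 1` over the `i ≥ M` among the left indices. -/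
def leftSum {n : ℕ} (X Y : Fin n → ℝ) (m : ℝ) (M : Fin n) : ℝ :=
  ∑ i ∈ leftIndices X m with M ≤ i, (2 * Y i - 1)

/-- `M` maximizes `F₊` over the right indices; if there are none, `M` is the last index `n`. -/
def IsRightChoice {n : ℕ} (X Y : Fin n → ℝ) (m : ℝ) (M : Fin n) : Prop :=
  ((rightIndices X m).Nonempty ∧ M ∈ rightIndices X m ∧
      ∀ M' ∈ rightIndices X m, rightSum X Y m M' ≤ rightSum X Y m M) ∨
    (rightIndices X m = ∅ ∧ (M : ℕ) + 1 = n)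

/-- `M` maximizes `F₋` over the left indices; if there are none, `M` is the first index `1`. -/
def IsLeftChoice {n : ℕ} (X Y : Fin n → ℝ) (m : ℝ) (M : Fin n) : Prop :=
  ((leftIndices X m).Nonempty ∧ M ∈ leftIndices X m ∧
      ∀ M' ∈ leftIndices X m, leftSum X Y m M' ≤ leftSum X Y m M) ∨
    (leftIndices X m = ∅ ∧ (M : ℕ) + 1 = 1)

/-- `G` is a value of the two-step estimate at the sample `(X₁, Y₁), …, (Xₙ, Yₙ)`: the first
subsample gives a least squares segment `[a, b]` with middle point `m`, and the second subsample
gives an endpoint of `G` on each side of `m`. Ties may be broken in any way. -/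
def IsTwoStepEstimate {n : ℕ} (X Y : Fin n → ℝ) (G : Set ℝ) : Prop :=
  ∃ a b : ℝ, a ≤ b ∧ IsLSE (evenIndices n) X Y (Icc a b) ∧
    ∃ Ml Mr : Fin n, IsLeftChoice X Y ((a + b) / 2) Ml ∧ IsRightChoice X Y ((a + b) / 2) Mr ∧
      G = Icc (X Ml) (X Mr)

/-- A two-step estimator: a map that assigns to every sample with ordered design points a two-step
estimate. -/
def IsTwoStepEstimator {n : ℕ} (T : (Fin n → ℝ) → (Fin n → ℝ) → Set ℝ) : Prop :=
  ∀ X Y : Fin n → ℝ, Monotone X → IsTwoStepEstimate X Y (T X Y)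

/-- The loss `|T △ G|` of the estimator `T` when the true segment is `G`, at a realization `u` of
the preliminary design and `ξ` of the noise. -/
def loss {n : ℕ} (T : (Fin n → ℝ) → (Fin n → ℝ) → Set ℝ) (G : Set ℝ) (u ξ : Fin n → ℝ) : ℝ :=
  nikodymDist (T (reorder u) (labels G (reorder u) ξ)) G

end SegmentRegression

end

/-!
The argument compares maximizers with the true segment `G = [g₁, g₂]` on a good event, which splits
into a statement on the design alone, and statements on the noise sums over blocks of consecutive
indices of one parity.

* `EvenNoiseSmall`: every noise sum over a block of even indices is at most a small multiple of `n`.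
  The criterion at a segment differs from the criterion at `G` by the number of even design points
  in the symmetric difference, up to such sums. As the design puts a positive fraction of its
  points in every fixed interval (`WellSpread` at a constant scale), the middle point `m` of the
  least squares segment lies in `G`, at a constant distance from the endpoints
  (`IsLSE.midpoint_mem`).
* `DriftDominates`: if `M*` is the last odd index with `X ≤ g₂`, then `F₊(M) - F₊(M*)` is, up to
  sign, a sum of `1 ± 2 ξᵢ` over a block of odd indices that starts or ends at the number of design
  points `≤ g₂`. This block does not depend on `m`, so the independence of the two subsamples plays
  no role. Given the design, the probability that such a sum has the wrong sign decays exponentially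
  in the length of the block. So the maximizer is within `t` indices of `M*`, except with
  probability `C exp (-γ t)`. The number of design points is independent of the noise, which is why
  no union over its values, and no factor `n`, is needed (`measureReal_mem_le_of_indepFun`).
* A distance of `h` between the endpoints forces `n h / 4` indices between them, except with
  probability `2 exp (-n h / 4)`, by Chernoff's bound (`WellSpread` at scale `h`).

Together these give a tail `exp (-c x)` (`exists_loss_tail`), which is better than `exp (-c √x)`.
The moments follow by summation over the grid of step `1 / n` (`lintegral_rpow_le_of_tail`), as the
loss is at most `1`. The estimator need not be measurable: only outer measures and lower integrals
are used.
-/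

namespace SegmentRegression

/-! ### Counting design points -/

open scoped Classical in
/-- The number of points of the design `u` that lie in `A`. -/
noncomputable def designCount {n : ℕ} (A : Set ℝ) (u : Fin n → ℝ) : ℕ :=
  (Finset.univ.filter fun i => u i ∈ A).card

lemma designCount_le {n : ℕ} (A : Set ℝ) (u : Fin n → ℝ) : designCount A u ≤ n := by
  classical
  exact (Finset.card_le_univ _).trans_eq (Fintype.card_fin n)

lemma designCount_reorder {n : ℕ} (A : Set ℝ) (u : Fin n → ℝ) :
    designCount A (reorder u) = designCount A u := by
  classical
  refine Finset.card_bij (fun i _ => Tuple.sort u i) ?_ ?_ ?_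
  · intro i hi
    exact Finset.mem_filter.2 ⟨Finset.mem_univ _, (Finset.mem_filter.1 hi).2⟩
  · intro i _ j _ h
    exact (Tuple.sort u).injective h
  · intro j hj
    refine ⟨(Tuple.sort u).symm j, Finset.mem_filter.2 ⟨Finset.mem_univ _, ?_⟩, by simp⟩
    simpa [reorder] using (Finset.mem_filter.1 hj).2

/-- In an ordered sample, the points in a lower set are the first ones. -/
lemma lt_designCount_iff {n : ℕ} {X : Fin n → ℝ} (hX : Monotone X) {A : Set ℝ}
    (hA : IsLowerSet A) (i : Fin n) : (i : ℕ) < designCount A X ↔ X i ∈ A := by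
  classical
  constructor
  · intro h
    by_contra hi
    have hsub : (Finset.univ.filter fun j => X j ∈ A) ⊆ Finset.Iio i := by
      intro j hj
      rw [Finset.mem_Iio]
      by_contra hij
      exact hi (hA (hX (not_lt.1 hij)) (Finset.mem_filter.1 hj).2)
    have := Finset.card_le_card hsub
    rw [Fin.card_Iio] at this
    exact absurd h (not_lt.2 this)
  · intro h
    have hsub : Finset.Iic i ⊆ (Finset.univ.filter fun j => X j ∈ A) := fun j hj =>
      Finset.mem_filter.2 ⟨Finset.mem_univ _, hA (hX (Finset.mem_Iic.1 hj)) h⟩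
    have := Finset.card_le_card hsub
    rwa [Fin.card_Iic] at this

lemma designCount_le_sub {n : ℕ} {X : Fin n → ℝ} {A : Set ℝ} {a b : ℕ}
    (h : ∀ i, X i ∈ A → a ≤ (i : ℕ) ∧ (i : ℕ) < b) : designCount A X ≤ b - a := by
  classical
  rw [← Nat.card_Ico]
  refine Finset.card_le_card_of_injOn (fun i => (i : ℕ)) ?_ fun i _ j _ hij => Fin.ext hij
  intro i hi
  simpa using h i (Finset.mem_filter.1 hi).2

/-- The elements of `I` that lie in `[a, b)`. -/
def block {n : ℕ} (I : Finset (Fin n)) (a b : ℕ) : Finset (Fin n) :=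
  I.filter fun i => a ≤ (i : ℕ) ∧ (i : ℕ) < b

lemma mem_block {n : ℕ} {I : Finset (Fin n)} {a b : ℕ} {i : Fin n} :
    i ∈ block I a b ↔ i ∈ I ∧ a ≤ (i : ℕ) ∧ (i : ℕ) < b := by
  simp [block]

lemma mem_evenIndices {n : ℕ} {i : Fin n} : i ∈ evenIndices n ↔ (i : ℕ) % 2 = 1 := by
  simp only [evenIndices, Finset.mem_filter, Finset.mem_univ, true_and, Nat.even_iff]
  omega

lemma mem_oddIndices {n : ℕ} {i : Fin n} : i ∈ oddIndices n ↔ (i : ℕ) % 2 = 0 := by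
  simp only [oddIndices, Finset.mem_filter, Finset.mem_univ, true_and, Nat.odd_iff]
  omega

/-- Every other index of `[a, b)` lies in `[a, b) ∩ I` if `I` contains a residue class mod `2`. -/
lemma le_two_mul_card_block {n r : ℕ} {I : Finset (Fin n)} (hr : r < 2)
    (hI : ∀ i : Fin n, (i : ℕ) % 2 = r → i ∈ I) {a b : ℕ} (hb : b ≤ n) :
    b - a ≤ 2 * (block I a b).card + 1 := by
  set δ := (a + r) % 2 with hδ
  have key : (b - a) / 2 ≤ (block I a b).card := by
    rw [← Finset.card_range ((b - a) / 2)]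
    refine le_trans ?_ (Finset.card_image_le (s := block I a b) (f := fun i => (i : ℕ)))
    refine Finset.card_le_card_of_injOn (fun j => a + 2 * j + δ) ?_ ?_
    · intro j hj
      have hj' : j < (b - a) / 2 := Finset.mem_range.1 hj
      have hlt : a + 2 * j + δ < b := by omega
      refine Finset.mem_coe.2 (Finset.mem_image.2 ⟨⟨a + 2 * j + δ, hlt.trans_le hb⟩, ?_, rfl⟩)
      refine mem_block.2 ⟨hI _ ?_, ?_, hlt⟩
      · change (a + 2 * j + δ) % 2 = r
        omega
      · change a ≤ a + 2 * j + δ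
        omega
    · intro i _ j _ hij
      have : a + 2 * i + δ = a + 2 * j + δ := hij
      omega
  omega

lemma two_mul_labels_sub_one_of_mem {n : ℕ} {G : Set ℝ} {X ξ : Fin n → ℝ} {i : Fin n}
    (h : X i ∈ G) : 2 * labels G X ξ i - 1 = 1 + 2 * ξ i := by
  simp only [labels, indicator_of_mem h, Pi.one_apply]
  ring

lemma two_mul_labels_sub_one_of_notMem {n : ℕ} {G : Set ℝ} {X ξ : Fin n → ℝ} {i : Fin n}
    (h : X i ∉ G) : 2 * labels G X ξ i - 1 = -(1 + -1 * (2 * ξ i)) := by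
  simp only [labels, indicator_of_notMem h]
  ring

open scoped Classical in
lemma filter_mem_Icc_eq_block {n : ℕ} {X : Fin n → ℝ} (hX : Monotone X) (I : Finset (Fin n))
    (p q : ℝ) :
    (I.filter fun i => X i ∈ Icc p q) =
      block I (designCount (Iio p) X) (designCount (Iic q) X) := by
  ext i
  rw [mem_block, Finset.mem_filter, lt_designCount_iff hX (isLowerSet_Iic q), ← not_lt,
    lt_designCount_iff hX (isLowerSet_Iio p)]
  simp

open scoped Classical in
lemma filter_mem_Ioo_eq_block {n : ℕ} {X : Fin n → ℝ} (hX : Monotone X) (I : Finset (Fin n))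
    (p q : ℝ) :
    (I.filter fun i => X i ∈ Ioo p q) =
      block I (designCount (Iic p) X) (designCount (Iio q) X) := by
  ext i
  rw [mem_block, Finset.mem_filter, lt_designCount_iff hX (isLowerSet_Iio q), ← not_lt,
    lt_designCount_iff hX (isLowerSet_Iic p)]
  simp

open scoped Classical in
/-- Half of the design points in an open interval belong to a given parity class, up to one. -/
lemma designCount_Ioo_le {n r : ℕ} {X : Fin n → ℝ} (hX : Monotone X) {I : Finset (Fin n)}
    (hr : r < 2) (hI : ∀ i : Fin n, (i : ℕ) % 2 = r → i ∈ I) (p q : ℝ) :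
    designCount (Ioo p q) X ≤ 2 * (I.filter fun i => X i ∈ Ioo p q).card + 1 := by
  rw [filter_mem_Ioo_eq_block hX]
  refine le_trans (designCount_le_sub fun i hi => ?_)
    (le_two_mul_card_block hr hI (designCount_le _ _))
  rw [lt_designCount_iff hX (isLowerSet_Iio q), ← not_lt, lt_designCount_iff hX (isLowerSet_Iic p)]
  exact ⟨not_le.2 hi.1, hi.2⟩

/-! ### The good event -/

/-- The design has, for its size, enough points within distance `h` on either side of `g`; a side
counts only if the interval of length `h` on that side is contained in `[0, 1]`. -/
def WellSpread {n : ℕ} (X : Fin n → ℝ) (g h : ℝ) : Prop :=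
  (0 ≤ g - h → n * h / 4 < designCount (Ioo (g - h) g) X) ∧
    (g + h ≤ 1 → n * h / 4 < designCount (Ioo g (g + h)) X)

/-- The noise is weaker than the drift on every block of odd indices that is longer than `t` and
starts or ends at `k`. -/
def DriftDominates {n : ℕ} (ξ : Fin n → ℝ) (k : ℕ) (t : ℝ) : Prop :=
  ∀ a b : ℕ, a ≤ n → b ≤ n → (a = k ∨ b = k) → t < (b - a : ℕ) → ∀ s : ℝ, s = 1 ∨ s = -1 →
    0 < ∑ i ∈ block (oddIndices n) a b, (1 + s * (2 * ξ i))

/-- The noise sums over all blocks of even indices are smaller than `δ`. -/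
def EvenNoiseSmall {n : ℕ} (ξ : Fin n → ℝ) (δ : ℝ) : Prop :=
  ∀ a b : ℕ, a ≤ n → b ≤ n → |∑ i ∈ block (evenIndices n) a b, ξ i| < δ

/-! ### The first step: the middle point is well inside the segment -/

/-- A least squares segment that misses, or exceeds, the true one on an interval with many design
points would need a large noise sum. -/
lemma IsLSE.designCount_lt {n : ℕ} {X ξ : Fin n → ℝ} (hX : Monotone X) {g₁ g₂ a b p q δ : ℝ}
    (hG : Icc g₁ g₂ ∈ segments) (hξ : EvenNoiseSmall ξ δ)
    (h : IsLSE (evenIndices n) X (labels (Icc g₁ g₂) X ξ) (Icc a b))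
    (hpq : Ioo p q ⊆ symmDiff (Icc g₁ g₂) (Icc a b)) :
    (designCount (Ioo p q) X : ℝ) < 8 * δ + 1 := by
  classical
  have hle : (∑ i ∈ evenIndices n with X i ∈ Icc g₁ g₂, (2 * labels (Icc g₁ g₂) X ξ i - 1)) ≤
      ∑ i ∈ evenIndices n with X i ∈ Icc a b, (2 * labels (Icc g₁ g₂) X ξ i - 1) := by
    convert h.2 _ hG using 1 <;> simp only [lsCriterion] <;> congr!
  have hA := abs_lt.1 (hξ _ _ (designCount_le (Iio a) X) (designCount_le (Iic b) X))
  have hB := abs_lt.1 (hξ _ _ (designCount_le (Iio g₁) X) (designCount_le (Iic g₂) X))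
  rw [← filter_mem_Icc_eq_block hX] at hA hB
  have hD : (designCount (Ioo p q) X : ℝ) ≤
      2 * ((evenIndices n).filter fun i => X i ∈ Ioo p q).card + 1 := by
    exact_mod_cast designCount_Ioo_le hX one_lt_two (fun i hi => mem_evenIndices.2 hi) p q
  have key : (((evenIndices n).filter fun i => X i ∈ Ioo p q).card : ℝ) +
      (∑ i ∈ evenIndices n with X i ∈ Icc a b, (2 * labels (Icc g₁ g₂) X ξ i - 1)) +
      2 * (∑ i ∈ evenIndices n with X i ∈ Icc g₁ g₂, ξ i) ≤
      (∑ i ∈ evenIndices n with X i ∈ Icc g₁ g₂, (2 * labels (Icc g₁ g₂) X ξ i - 1)) +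
      2 * (∑ i ∈ evenIndices n with X i ∈ Icc a b, ξ i) := by
    rw [Finset.card_eq_sum_ones]
    push_cast
    simp only [Finset.sum_filter, Finset.mul_sum]
    rw [← Finset.sum_add_distrib, ← Finset.sum_add_distrib, ← Finset.sum_add_distrib]
    refine Finset.sum_le_sum fun i _ => ?_
    by_cases hJ : X i ∈ Ioo p q
    · rcases hpq hJ with ⟨h1, h2⟩ | ⟨h1, h2⟩
      · simp only [if_pos hJ, if_pos h1, if_neg h2, two_mul_labels_sub_one_of_mem h1]
        linarith
      · simp only [if_pos hJ, if_pos h1, if_neg h2, two_mul_labels_sub_one_of_notMem h2]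
        linarith
    · by_cases h1 : X i ∈ Icc g₁ g₂ <;> by_cases h2 : X i ∈ Icc a b
      · simp only [if_neg hJ, if_pos h1, if_pos h2]
        linarith
      · simp only [if_neg hJ, if_pos h1, if_neg h2, two_mul_labels_sub_one_of_mem h1]
        linarith
      · simp only [if_neg hJ, if_neg h1, if_pos h2, two_mul_labels_sub_one_of_notMem h1]
        linarith
      · simp only [if_neg hJ, if_neg h1, if_neg h2]
        linarith
  linarith [hA.1, hA.2, hB.1, hB.2]

/-- If the middle point of `[a, b]` were within `h` of an endpoint of the true segment, or beyond
it, then `[a, b]` would miss an interval of length `h` at the far end of the true segment or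
exceed the near end by such an interval. -/
lemma IsLSE.midpoint_mem {n : ℕ} {X ξ : Fin n → ℝ} (hX : Monotone X) {g₁ g₂ a b h : ℝ}
    (h0 : 0 ≤ g₁) (h1 : g₂ ≤ 1) (hh : 0 < h) (hlen : g₁ + 8 * h ≤ g₂) (hab : a ≤ b)
    (hn : 8 ≤ n * h) (hw₁ : WellSpread X g₁ h) (hw₂ : WellSpread X g₂ h)
    (hξ : EvenNoiseSmall ξ (n * h / 64))
    (hlse : IsLSE (evenIndices n) X (labels (Icc g₁ g₂) X ξ) (Icc a b)) :
    (a + b) / 2 ∈ Icc (g₁ + h) (g₂ - h) := by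
  have hG : Icc g₁ g₂ ∈ segments := ⟨g₁, g₂, h0, by linarith, h1, rfl⟩
  have ha : 0 ≤ a ∧ b ≤ 1 := by
    obtain ⟨a', b', ha', hab', hb', he⟩ := hlse.1
    have h3 : a ∈ Icc a' b' := he ▸ left_mem_Icc.2 hab
    have h4 : b ∈ Icc a' b' := he ▸ right_mem_Icc.2 hab
    exact ⟨ha'.trans h3.1, h4.2.trans hb'⟩
  have miss : ∀ p q : ℝ, n * h / 4 < designCount (Ioo p q) X →
      Ioo p q ⊆ symmDiff (Icc g₁ g₂) (Icc a b) → False := by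
    intro p q hc hs
    have := hlse.designCount_lt hX hG hξ hs
    linarith
  constructor
  · by_contra! hm
    by_cases hb : b ≤ g₂ - h
    · refine miss _ _ (hw₂.1 (by linarith)) fun z hz => Or.inl ⟨⟨?_, hz.2.le⟩, fun hz' => ?_⟩
      · linarith [hz.1]
      · linarith [hz.1, hz'.2]
    · refine miss _ _ (hw₁.1 (by linarith)) fun z hz => Or.inr ⟨⟨?_, ?_⟩, fun hz' => ?_⟩
      · linarith [hz.1]
      · linarith [hz.2]
      · linarith [hz.2, hz'.1]
  · by_contra! hm
    by_cases ha' : g₁ + h ≤ a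
    · refine miss _ _ (hw₁.2 (by linarith)) fun z hz => Or.inl ⟨⟨hz.1.le, ?_⟩, fun hz' => ?_⟩
      · linarith [hz.2]
      · linarith [hz.2, hz'.1]
    · refine miss _ _ (hw₂.2 (by linarith)) fun z hz => Or.inr ⟨⟨?_, ?_⟩, fun hz' => ?_⟩
      · linarith [hz.1]
      · linarith [hz.2]
      · linarith [hz.1, hz'.2]

/-! ### The second step: the endpoints are well located -/

lemma exists_oddIndices_mem_Ioo {n : ℕ} {X : Fin n → ℝ} (hX : Monotone X) {p q : ℝ}
    (h : 1 < designCount (Ioo p q) X) : ∃ i ∈ oddIndices n, X i ∈ Ioo p q := by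
  classical
  have := designCount_Ioo_le hX two_pos (fun i hi => mem_oddIndices.2 hi) p q
  obtain ⟨i, hi⟩ := Finset.card_pos.1
    (show 0 < ((oddIndices n).filter fun i => X i ∈ Ioo p q).card by omega)
  exact ⟨i, Finset.mem_filter.1 hi⟩

/-- The right endpoint of the two-step estimate is within `h` of `g₂`. A larger distance would, by
`WellSpread`, put more than `n h / 4` indices between the maximizer of `F₊` and the last index with
`X ≤ g₂`, and the drift on the odd ones among them would contradict maximality. The index `p`
guarantees that the last odd index with `X ≤ g₂` is one of the right indices. -/
lemma abs_right_sub_lt {n : ℕ} {X ξ : Fin n → ℝ} (hX : Monotone X) (hX01 : ∀ i, X i ∈ Icc 0 1)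
    {g₁ g₂ m h : ℝ} {p r : Fin n} (hh : 0 < h) (hm : g₁ ≤ m) (hp : p ∈ oddIndices n)
    (hmp : m ≤ X p) (hpg : X p < g₂) (hw : WellSpread X g₂ h)
    (hξ : DriftDominates ξ (designCount (Iic g₂) X) (n * h / 4))
    (hr : IsRightChoice X (labels (Icc g₁ g₂) X ξ) m r) : |X r - g₂| < h := by
  classical
  set k := designCount (Iic g₂) X with hk
  have hlt : ∀ i : Fin n, (i : ℕ) < k ↔ X i ≤ g₂ := lt_designCount_iff hX (isLowerSet_Iic g₂)
  have hkn : k ≤ n := designCount_le _ _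
  have hpR : p ∈ rightIndices X m := Finset.mem_filter.2 ⟨hp, hmp⟩
  rcases hr with ⟨-, hrR, hmax⟩ | ⟨he, -⟩
  swap
  · simp [he] at hpR
  obtain ⟨hro, hmr⟩ := Finset.mem_filter.1 hrR
  -- the last odd index whose design point does not exceed the right endpoint
  obtain ⟨N, hN, hNmax⟩ := ((oddIndices n).filter fun i => X i ≤ g₂).exists_max_image id
    ⟨p, Finset.mem_filter.2 ⟨hp, hpg.le⟩⟩
  obtain ⟨hNo, hNg⟩ := Finset.mem_filter.1 hN
  have hNlast : ∀ i ∈ oddIndices n, i ≤ N ↔ (i : ℕ) < k := fun i hi => by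
    rw [hlt]
    exact ⟨fun h => (hX h).trans hNg, fun h => hNmax i (Finset.mem_filter.2 ⟨hi, h⟩)⟩
  have hmN : m ≤ X N := hmp.trans (hX (hNmax p (Finset.mem_filter.2 ⟨hp, hpg.le⟩)))
  have hF := hmax N (Finset.mem_filter.2 ⟨hNo, hmN⟩)
  rw [abs_lt]
  constructor
  · by_contra! hbad
    have hrN : r ≤ N := (hNlast r hro).2 ((hlt r).2 (by linarith))
    have hsum := hξ (r + 1) k (by omega) hkn (Or.inr rfl) ?_ 1 (Or.inl rfl)
    · have hsplit : rightSum X (labels (Icc g₁ g₂) X ξ) m N =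
          rightSum X (labels (Icc g₁ g₂) X ξ) m r +
            ∑ i ∈ block (oddIndices n) (r + 1) k, (1 + 1 * (2 * ξ i)) := by
        rw [rightSum, rightSum]
        have hd : Disjoint ((rightIndices X m).filter fun i => i ≤ r)
            (block (oddIndices n) (r + 1) k) := by
          rw [Finset.disjoint_left]
          intro i hi hi'
          have h1 := (Finset.mem_filter.1 hi).2
          have h2 := (mem_block.1 hi').2.1
          exact absurd (Fin.le_def.1 h1) (by omega)
        have hu : ((rightIndices X m).filter fun i => i ≤ N) =
            ((rightIndices X m).filter fun i => i ≤ r) ∪ block (oddIndices n) (r + 1) k := by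
          ext i
          simp only [Finset.mem_union, Finset.mem_filter, mem_block, rightIndices]
          constructor
          · rintro ⟨⟨hio, hmi⟩, hiN⟩
            rcases le_or_gt i r with h | h
            · exact Or.inl ⟨⟨hio, hmi⟩, h⟩
            · exact Or.inr ⟨hio, Fin.lt_def.1 h, (hNlast i hio).1 hiN⟩
          · rintro (⟨⟨hio, hmi⟩, h⟩ | ⟨hio, h1, h2⟩)
            · exact ⟨⟨hio, hmi⟩, h.trans hrN⟩
            · exact ⟨⟨hio, hmr.trans (hX (Fin.le_def.2 (by omega)))⟩, (hNlast i hio).2 h2⟩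
        rw [hu, Finset.sum_union hd]
        congr 1
        refine Finset.sum_congr rfl fun i hi => ?_
        obtain ⟨-, h1, h2⟩ := mem_block.1 hi
        rw [two_mul_labels_sub_one_of_mem, one_mul]
        exact ⟨hm.trans (hmr.trans (hX (Fin.le_def.2 (by omega)))), (hlt i).1 h2⟩
      linarith
    · refine (hw.1 (by linarith [(hX01 r).1])).trans_le ?_
      exact_mod_cast designCount_le_sub fun i (hi : X i ∈ Ioo _ _) => ⟨by
        by_contra! h
        have := hX (Fin.le_def.2 (show (i : ℕ) ≤ r by omega))
        linarith [hi.1], (hlt i).2 hi.2.le⟩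
  · by_contra! hbad
    have hkr : k ≤ r := by
      by_contra! h
      linarith [(hlt r).1 h]
    have hNr : N ≤ r := by
      by_contra! h
      have := (hNlast r hro).1 h.le
      omega
    have hsum := hξ k (r + 1) hkn (by omega) (Or.inl rfl) ?_ (-1) (Or.inr rfl)
    · have hsplit : rightSum X (labels (Icc g₁ g₂) X ξ) m r =
          rightSum X (labels (Icc g₁ g₂) X ξ) m N +
            -∑ i ∈ block (oddIndices n) k (r + 1), (1 + -1 * (2 * ξ i)) := by
        rw [rightSum, rightSum]
        have hd : Disjoint ((rightIndices X m).filter fun i => i ≤ N)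
            (block (oddIndices n) k (r + 1)) := by
          rw [Finset.disjoint_left]
          intro i hi hi'
          have h1 := (hNlast i (mem_block.1 hi').1).1 (Finset.mem_filter.1 hi).2
          have h2 := (mem_block.1 hi').2.1
          omega
        have hu : ((rightIndices X m).filter fun i => i ≤ r) =
            ((rightIndices X m).filter fun i => i ≤ N) ∪ block (oddIndices n) k (r + 1) := by
          ext i
          simp only [Finset.mem_union, Finset.mem_filter, mem_block, rightIndices]
          constructor
          · rintro ⟨⟨hio, hmi⟩, hiN⟩
            rcases lt_or_ge (i : ℕ) k with h | h
            · exact Or.inl ⟨⟨hio, hmi⟩, (hNlast i hio).2 h⟩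
            · exact Or.inr ⟨hio, h, Nat.lt_succ_of_le hiN⟩
          · rintro (⟨⟨hio, hmi⟩, h⟩ | ⟨hio, h1, h2⟩)
            · exact ⟨⟨hio, hmi⟩, h.trans hNr⟩
            · refine ⟨⟨hio, ?_⟩, Nat.le_of_lt_succ h2⟩
              by_contra! h
              have := (hlt i).2 (by linarith)
              omega
        rw [hu, Finset.sum_union hd, ← Finset.sum_neg_distrib]
        congr 1
        refine Finset.sum_congr rfl fun i hi => ?_
        obtain ⟨-, h1, h2⟩ := mem_block.1 hi
        rw [two_mul_labels_sub_one_of_notMem]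
        intro hiG
        have := (hlt i).2 hiG.2
        omega
      linarith
    · refine (hw.2 (by linarith [(hX01 r).2])).trans_le ?_
      exact_mod_cast designCount_le_sub fun i (hi : X i ∈ Ioo _ _) => ⟨by
        by_contra! h
        linarith [(hlt i).1 h, hi.1], by
        by_contra! h
        have := hX (Fin.le_def.2 (show (r : ℕ) ≤ i by omega))
        linarith [hi.2]⟩

/-- The counterpart of `abs_right_sub_lt` for the left endpoint. -/
lemma abs_left_sub_lt {n : ℕ} {X ξ : Fin n → ℝ} (hX : Monotone X) (hX01 : ∀ i, X i ∈ Icc 0 1)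
    {g₁ g₂ m h : ℝ} {p l : Fin n} (hh : 0 < h) (hm : m ≤ g₂) (hp : p ∈ oddIndices n)
    (hmp : X p < m) (hpg : g₁ < X p) (hw : WellSpread X g₁ h)
    (hξ : DriftDominates ξ (designCount (Iio g₁) X) (n * h / 4))
    (hl : IsLeftChoice X (labels (Icc g₁ g₂) X ξ) m l) : |X l - g₁| < h := by
  classical
  set k := designCount (Iio g₁) X with hk
  have hlt : ∀ i : Fin n, (i : ℕ) < k ↔ X i < g₁ := lt_designCount_iff hX (isLowerSet_Iio g₁)
  have hkn : k ≤ n := designCount_le _ _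
  have hpL : p ∈ leftIndices X m := Finset.mem_filter.2 ⟨hp, hmp⟩
  rcases hl with ⟨-, hlL, hmax⟩ | ⟨he, -⟩
  swap
  · simp [he] at hpL
  obtain ⟨hlo, hlm⟩ := Finset.mem_filter.1 hlL
  -- the first odd index whose design point is not below the left endpoint
  obtain ⟨N, hN, hNmin⟩ := ((oddIndices n).filter fun i => g₁ ≤ X i).exists_min_image id
    ⟨p, Finset.mem_filter.2 ⟨hp, hpg.le⟩⟩
  obtain ⟨hNo, hNg⟩ := Finset.mem_filter.1 hN
  have hNfirst : ∀ i ∈ oddIndices n, N ≤ i ↔ k ≤ (i : ℕ) := fun i hi => by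
    rw [← not_lt (a := (i : ℕ)), hlt, not_lt]
    exact ⟨fun h => hNg.trans (hX h), fun h => hNmin i (Finset.mem_filter.2 ⟨hi, h⟩)⟩
  have hNm : X N < m := (hX (hNmin p (Finset.mem_filter.2 ⟨hp, hpg.le⟩))).trans_lt hmp
  have hF := hmax N (Finset.mem_filter.2 ⟨hNo, hNm⟩)
  rw [abs_lt]
  constructor
  · by_contra! hbad
    have hlk : (l : ℕ) < k := (hlt l).2 (by linarith)
    have hlN : l ≤ N := by
      by_contra! h
      have := (hNfirst l hlo).1 h.le
      omega
    have hsum := hξ l k (by omega) hkn (Or.inr rfl) ?_ (-1) (Or.inr rfl)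
    · have hsplit : leftSum X (labels (Icc g₁ g₂) X ξ) m l =
          leftSum X (labels (Icc g₁ g₂) X ξ) m N +
            -∑ i ∈ block (oddIndices n) l k, (1 + -1 * (2 * ξ i)) := by
        rw [leftSum, leftSum]
        have hd : Disjoint ((leftIndices X m).filter fun i => N ≤ i)
            (block (oddIndices n) l k) := by
          rw [Finset.disjoint_left]
          intro i hi hi'
          have h1 := (hNfirst i (mem_block.1 hi').1).1 (Finset.mem_filter.1 hi).2
          have h2 := (mem_block.1 hi').2.2
          omega
        have hu : ((leftIndices X m).filter fun i => l ≤ i) =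
            ((leftIndices X m).filter fun i => N ≤ i) ∪ block (oddIndices n) l k := by
          ext i
          simp only [Finset.mem_union, Finset.mem_filter, mem_block, leftIndices]
          constructor
          · rintro ⟨⟨hio, him⟩, hli⟩
            rcases lt_or_ge (i : ℕ) k with h | h
            · exact Or.inr ⟨hio, Fin.le_def.1 hli, h⟩
            · exact Or.inl ⟨⟨hio, him⟩, (hNfirst i hio).2 h⟩
          · rintro (⟨⟨hio, him⟩, h⟩ | ⟨hio, h1, h2⟩)
            · exact ⟨⟨hio, him⟩, hlN.trans h⟩
            · exact ⟨⟨hio, by linarith [(hlt i).1 h2]⟩, Fin.le_def.2 h1⟩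
        rw [hu, Finset.sum_union hd, ← Finset.sum_neg_distrib]
        congr 1
        refine Finset.sum_congr rfl fun i hi => ?_
        obtain ⟨-, h1, h2⟩ := mem_block.1 hi
        rw [two_mul_labels_sub_one_of_notMem]
        intro hiG
        exact absurd ((hlt i).1 h2) (not_lt.2 hiG.1)
      linarith
    · refine (hw.1 (by linarith [(hX01 l).1])).trans_le ?_
      exact_mod_cast designCount_le_sub fun i (hi : X i ∈ Ioo _ _) => ⟨by
        by_contra! h
        have := hX (Fin.le_def.2 h.le)
        linarith [hi.1], (hlt i).2 hi.2⟩
  · by_contra! hbad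
    have hNl : N ≤ l := hNmin l (Finset.mem_filter.2 ⟨hlo, by linarith⟩)
    have hsum := hξ k l hkn (by omega) (Or.inl rfl) ?_ 1 (Or.inl rfl)
    · have hsplit : leftSum X (labels (Icc g₁ g₂) X ξ) m N =
          leftSum X (labels (Icc g₁ g₂) X ξ) m l +
            ∑ i ∈ block (oddIndices n) k l, (1 + 1 * (2 * ξ i)) := by
        rw [leftSum, leftSum]
        have hd : Disjoint ((leftIndices X m).filter fun i => l ≤ i)
            (block (oddIndices n) k l) := by
          rw [Finset.disjoint_left]
          intro i hi hi'
          have h1 := Fin.le_def.1 (Finset.mem_filter.1 hi).2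
          have h2 := (mem_block.1 hi').2.2
          omega
        have hu : ((leftIndices X m).filter fun i => N ≤ i) =
            ((leftIndices X m).filter fun i => l ≤ i) ∪ block (oddIndices n) k l := by
          ext i
          simp only [Finset.mem_union, Finset.mem_filter, mem_block, leftIndices]
          constructor
          · rintro ⟨⟨hio, him⟩, hNi⟩
            rcases le_or_gt l i with h | h
            · exact Or.inl ⟨⟨hio, him⟩, h⟩
            · exact Or.inr ⟨hio, (hNfirst i hio).1 hNi, Fin.lt_def.1 h⟩
          · rintro (⟨⟨hio, him⟩, h⟩ | ⟨hio, h1, h2⟩)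
            · exact ⟨⟨hio, him⟩, hNl.trans h⟩
            · exact ⟨⟨hio, (hX (Fin.le_def.2 h2.le)).trans_lt hlm⟩, (hNfirst i hio).2 h1⟩
        rw [hu, Finset.sum_union hd]
        congr 1
        refine Finset.sum_congr rfl fun i hi => ?_
        obtain ⟨-, h1, h2⟩ := mem_block.1 hi
        rw [two_mul_labels_sub_one_of_mem, one_mul]
        refine ⟨not_lt.1 fun h => absurd ((hlt i).2 h) (by omega), ?_⟩
        linarith [hX (Fin.le_def.2 h2.le)]
      linarith
    · refine (hw.2 (by linarith [(hX01 l).2])).trans_le ?_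
      exact_mod_cast designCount_le_sub fun i (hi : X i ∈ Ioo _ _) => ⟨by
        by_contra! h
        linarith [(hlt i).1 h, hi.1], by
        by_contra! h
        have := hX (Fin.le_def.2 h)
        linarith [hi.2]⟩

lemma nikodymDist_Icc_le (a b c d : ℝ) :
    nikodymDist (Icc a b) (Icc c d) ≤ |a - c| + |b - d| := by
  have hsub : symmDiff (Icc a b) (Icc c d) ⊆ uIcc a c ∪ uIcc b d := by
    rintro z (⟨hz, hz'⟩ | ⟨hz, hz'⟩)
    · rcases lt_or_ge z c with h | h
      · exact Or.inl (Icc_subset_uIcc ⟨hz.1, h.le⟩)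
      · exact Or.inr (Icc_subset_uIcc' ⟨not_le.1 (fun h' => hz' ⟨h, h'⟩) |>.le, hz.2⟩)
    · rcases lt_or_ge z a with h | h
      · exact Or.inl (Icc_subset_uIcc' ⟨hz.1, h.le⟩)
      · exact Or.inr (Icc_subset_uIcc ⟨not_le.1 (fun h' => hz' ⟨h, h'⟩) |>.le, hz.2⟩)
  have hfin : volume (uIcc a c ∪ uIcc b d) ≠ ⊤ :=
    ((isCompact_uIcc.union isCompact_uIcc).measure_lt_top).ne
  refine (measureReal_mono hsub hfin).trans ((measureReal_union_le _ _).trans ?_)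
  rw [measureReal_def, measureReal_def, Real.volume_interval, Real.volume_interval,
    ENNReal.toReal_ofReal (abs_nonneg _), ENNReal.toReal_ofReal (abs_nonneg _),
    abs_sub_comm a, abs_sub_comm b]

/-- The deterministic core: on the good event the loss of a two-step estimate is small. -/
lemma nikodymDist_lt_of_isTwoStepEstimate {n : ℕ} {X ξ : Fin n → ℝ} (hX : Monotone X)
    (hX01 : ∀ i, X i ∈ Icc 0 1) {g₁ g₂ h h' : ℝ} (h0 : 0 ≤ g₁) (h1 : g₂ ≤ 1) (hh : 0 < h)
    (hh' : 0 < h') (hlen : g₁ + 8 * h ≤ g₂) (hn : 8 ≤ n * h)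
    (hw₁ : WellSpread X g₁ h) (hw₂ : WellSpread X g₂ h)
    (hw₁' : WellSpread X g₁ h') (hw₂' : WellSpread X g₂ h')
    (hξ : EvenNoiseSmall ξ (n * h / 64))
    (hξ₁ : DriftDominates ξ (designCount (Iio g₁) X) (n * h' / 4))
    (hξ₂ : DriftDominates ξ (designCount (Iic g₂) X) (n * h' / 4))
    {S : Set ℝ} (hS : IsTwoStepEstimate X (labels (Icc g₁ g₂) X ξ) S) :
    nikodymDist S (Icc g₁ g₂) < 2 * h' := by
  obtain ⟨a, b, hab, hlse, l, r, hl, hr, rfl⟩ := hS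
  obtain ⟨hm₁, hm₂⟩ := hlse.midpoint_mem hX h0 h1 hh hlen hab hn hw₁ hw₂ hξ
  have hc : ∀ c : ℕ, n * h / 4 < c → 1 < c := fun c hc => by
    have : (1 : ℝ) < c := by linarith
    exact_mod_cast this
  obtain ⟨p, hp, hpm⟩ := exists_oddIndices_mem_Ioo hX (hc _ (hw₂.1 (by linarith)))
  obtain ⟨q, hq, hqm⟩ := exists_oddIndices_mem_Ioo hX (hc _ (hw₁.2 (by linarith)))
  have hR := abs_right_sub_lt hX hX01 hh' (by linarith) hp (hm₂.trans hpm.1.le) hpm.2 hw₂' hξ₂ hr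
  have hL := abs_left_sub_lt hX hX01 hh' (by linarith) hq (hqm.2.trans_le hm₁) hqm.1 hw₁' hξ₁ hl
  linarith [nikodymDist_Icc_le (X l) (X r) g₁ g₂]

/-! ### Probability of the good event: noise -/

section Noise

variable {Ω : Type*} [MeasurableSpace Ω] {P : Measure Ω} {σ : ℝ} {n : ℕ} {U ξ : Fin n → Ω → ℝ}

/-- Hoeffding's bound for the noise sums, with a sign `s`. -/
lemma IsRandomDesignModel.noise_sum_tail (h : IsRandomDesignModel P σ U ξ) (S : Finset (Fin n))
    {s : ℝ} (hs : s = 1 ∨ s = -1) {ε : ℝ} (hε : 0 ≤ ε) :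
    P.real {ω | ε ≤ ∑ i ∈ S, s * ξ i ω} ≤ Real.exp (-ε ^ 2 / (2 * (S.card * σ ^ 2))) := by
  have hind : iIndepFun (fun i ω => s * ξ i ω) P :=
    h.noise_indep.comp (fun _ x => s * x) fun _ => measurable_const_mul s
  obtain ⟨v, hv, hξ⟩ : ∃ v : NNReal, (v : ℝ) = σ ^ 2 ∧ ∀ i, HasSubgaussianMGF (ξ i) v P :=
    ⟨⟨σ ^ 2, sq_nonneg σ⟩, rfl, h.noise_subgaussian⟩
  have hsub : ∀ i ∈ S, HasSubgaussianMGF (fun ω => s * ξ i ω) v P := by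
    intro i _
    rcases hs with rfl | rfl
    · simpa using hξ i
    · have e : (fun ω => -1 * ξ i ω) = -ξ i := by
        ext ω
        simp
      rw [e]
      exact (hξ i).neg
  have := HasSubgaussianMGF.measure_sum_ge_le_of_iIndepFun hind hsub hε
  simpa [hv] using this

lemma IsRandomDesignModel.evenNoiseSmall_compl_le [IsProbabilityMeasure P]
    (h : IsRandomDesignModel P σ U ξ) (hσ : 0 < σ) {δ : ℝ} (hδ : 0 < δ) :
    P.real {ω | ¬EvenNoiseSmall (fun i => ξ i ω) δ} ≤
      2 * (n + 1) ^ 2 * Real.exp (-δ ^ 2 / (2 * (n * σ ^ 2))) := by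
  have hone : ∀ S : Finset (Fin n), ∀ s : ℝ, (s = 1 ∨ s = -1) →
      P.real {ω | δ ≤ ∑ i ∈ S, s * ξ i ω} ≤ Real.exp (-δ ^ 2 / (2 * (n * σ ^ 2))) := by
    intro S s hs
    rcases S.eq_empty_or_nonempty with rfl | hS
    · -- for the empty block the exponent of `noise_sum_tail` is the junk value `0`
      simp [not_le.2 hδ, Real.exp_nonneg]
    · refine (h.noise_sum_tail S hs hδ.le).trans (Real.exp_le_exp.2 ?_)
      have h1 : (S.card : ℝ) ≤ n := by
        exact_mod_cast (Finset.card_le_univ S).trans_eq (Fintype.card_fin n)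
      have h2 : (0 : ℝ) < S.card := by exact_mod_cast hS.card_pos
      rw [neg_div, neg_div]
      gcongr
  have hsub : {ω | ¬EvenNoiseSmall (fun i => ξ i ω) δ} ⊆
      ⋃ p ∈ Finset.range (n + 1) ×ˢ Finset.range (n + 1),
        ({ω | δ ≤ ∑ i ∈ block (evenIndices n) p.1 p.2, 1 * ξ i ω} ∪
          {ω | δ ≤ ∑ i ∈ block (evenIndices n) p.1 p.2, -1 * ξ i ω}) := by
    intro ω hω
    simp only [EvenNoiseSmall, mem_ofPred_eq, not_forall, not_lt] at hω
    obtain ⟨a, b, ha, hb, hab⟩ := hω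
    simp only [mem_iUnion]
    refine ⟨(a, b), by simp; omega, ?_⟩
    rcases le_abs.1 hab with h | h
    · exact Or.inl (by simpa using h)
    · exact Or.inr (by simpa using h)
  refine (measureReal_mono hsub (measure_ne_top _ _)).trans
    ((measureReal_biUnion_finset_le _ _).trans ?_)
  refine (Finset.sum_le_card_nsmul _ _ (2 * Real.exp (-δ ^ 2 / (2 * (n * σ ^ 2)))) ?_).trans_eq ?_
  · intro p _
    refine (measureReal_union_le _ _).trans ?_
    linarith [hone (block (evenIndices n) p.1 p.2) 1 (Or.inl rfl),
      hone (block (evenIndices n) p.1 p.2) (-1) (Or.inr rfl)]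
  · simp
    ring

/-- Noise samples whose sum beats the drift on a block of `l` indices that starts or ends at `k`. -/
def driftFailure (n k l : ℕ) (s : ℝ) : Set (Fin n → ℝ) :=
  {x | (k + l ≤ n ∧ ∑ i ∈ block (oddIndices n) k (k + l), (1 + s * (2 * x i)) ≤ 0) ∨
    ((l ≤ k ∧ k ≤ n) ∧ ∑ i ∈ block (oddIndices n) (k - l) k, (1 + s * (2 * x i)) ≤ 0)}

lemma measurableSet_driftFailure (n k l : ℕ) (s : ℝ) : MeasurableSet (driftFailure n k l s) := by
  have hS : ∀ S : Finset (Fin n),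
      MeasurableSet {x : Fin n → ℝ | ∑ i ∈ S, (1 + s * (2 * x i)) ≤ 0} := fun S =>
    measurableSet_le (by fun_prop) measurable_const
  exact ((MeasurableSet.const _).inter (hS _)).union ((MeasurableSet.const _).inter (hS _))

/-- On a block of length at least `l`, which has at least `(l - 1) / 2` odd indices, the noise
exceeds the drift with probability at most `exp (-γ (l - 1))`, where `γ = 1 / (16 σ²)`. -/
lemma IsRandomDesignModel.drift_block_le [IsProbabilityMeasure P]
    (h : IsRandomDesignModel P σ U ξ) (hσ : 0 < σ) {a b l : ℕ} (hb : b ≤ n) (hl : l ≤ b - a)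
    {s : ℝ} (hs : s = 1 ∨ s = -1) :
    P.real {ω | ∑ i ∈ block (oddIndices n) a b, (1 + s * (2 * ξ i ω)) ≤ 0} ≤
      Real.exp (1 / (16 * σ ^ 2)) * Real.exp (-(1 / (16 * σ ^ 2))) ^ l := by
  set S := block (oddIndices n) a b with hS
  have hcard : (l : ℝ) ≤ 2 * S.card + 1 := by
    exact_mod_cast hl.trans (le_two_mul_card_block two_pos (fun i hi => mem_oddIndices.2 hi) hb)
  have hsub : {ω | ∑ i ∈ S, (1 + s * (2 * ξ i ω)) ≤ 0} ⊆
      {ω | (S.card : ℝ) / 2 ≤ ∑ i ∈ S, -s * ξ i ω} := by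
    intro ω hω
    simp only [mem_ofPred_eq, Finset.sum_add_distrib, ← Finset.mul_sum] at hω ⊢
    simp only [Finset.sum_const, nsmul_eq_mul, mul_one] at hω
    linarith
  refine (measureReal_mono hsub (measure_ne_top _ _)).trans
    ((h.noise_sum_tail S ?_ (by positivity)).trans ?_)
  · rcases hs with rfl | rfl <;> simp
  · rw [← Real.exp_nat_mul, ← Real.exp_add, Real.exp_le_exp]
    have hσ2 : 0 < σ ^ 2 := by positivity
    rcases Nat.eq_zero_or_pos S.card with h0 | h0
    · rw [h0] at hcard ⊢
      have : (1 - (l : ℝ)) * (1 / (16 * σ ^ 2)) ≥ 0 :=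
        mul_nonneg (by push_cast at hcard; linarith) (by positivity)
      simp only [Nat.cast_zero, zero_div, ne_eq, OfNat.ofNat_ne_zero, not_false_eq_true, zero_pow,
        neg_zero]
      linarith
    · have h0' : (0 : ℝ) < S.card := by exact_mod_cast h0
      have e : -((S.card : ℝ) / 2) ^ 2 / (2 * (S.card * σ ^ 2)) =
          -(2 * S.card) * (1 / (16 * σ ^ 2)) := by
        field_simp
        norm_num
      rw [e]
      have : (2 * S.card + 1 - (l : ℝ)) * (1 / (16 * σ ^ 2)) ≥ 0 :=
        mul_nonneg (by linarith) (by positivity)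
      linarith

lemma IsRandomDesignModel.driftFailure_le [IsProbabilityMeasure P]
    (h : IsRandomDesignModel P σ U ξ) (hσ : 0 < σ) (k l : ℕ) {s : ℝ} (hs : s = 1 ∨ s = -1) :
    P.real {ω | (fun i => ξ i ω) ∈ driftFailure n k l s} ≤
      2 * Real.exp (1 / (16 * σ ^ 2)) * Real.exp (-(1 / (16 * σ ^ 2))) ^ l := by
  have hc : 0 ≤ Real.exp (1 / (16 * σ ^ 2)) * Real.exp (-(1 / (16 * σ ^ 2))) ^ l := by positivity
  have hone : ∀ (q : Prop) (A : Set Ω), (q → P.real A ≤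
      Real.exp (1 / (16 * σ ^ 2)) * Real.exp (-(1 / (16 * σ ^ 2))) ^ l) →
      P.real {ω | q ∧ ω ∈ A} ≤
        Real.exp (1 / (16 * σ ^ 2)) * Real.exp (-(1 / (16 * σ ^ 2))) ^ l := by
    intro q A hA
    by_cases hq : q
    · simpa [hq] using hA hq
    · simpa [hq] using hc
  have h1 := hone _ _ fun hq : k + l ≤ n =>
    h.drift_block_le hσ (a := k) (l := l) hq (by omega) hs
  have h2 := hone _ _ fun hq : l ≤ k ∧ k ≤ n =>
    h.drift_block_le hσ (a := k - l) (b := k) (l := l) hq.2 (by omega) hs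
  exact ((measureReal_union_le _ _).trans (add_le_add h1 h2)).trans_eq (by ring)

/-- Noise samples for which the drift does not dominate on blocks longer than `t`. -/
def driftFailureUnion (n : ℕ) (t : ℝ) (k : ℕ) : Set (Fin n → ℝ) :=
  ⋃ l ∈ (Finset.range (n + 1)).filter fun l : ℕ => t < l,
    (driftFailure n k l 1 ∪ driftFailure n k l (-1))

lemma measurableSet_driftFailureUnion (n : ℕ) (t : ℝ) (k : ℕ) :
    MeasurableSet (driftFailureUnion n t k) :=
  Finset.measurableSet_biUnion _ fun l _ =>
    (measurableSet_driftFailure n k l 1).union (measurableSet_driftFailure n k l (-1))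

lemma mem_driftFailureUnion_of_not {x : Fin n → ℝ} {k : ℕ} {t : ℝ} (ht : 0 ≤ t)
    (h : ¬DriftDominates x k t) :
    x ∈ driftFailureUnion n t k := by
  simp only [DriftDominates, not_forall, not_lt] at h
  obtain ⟨a, b, ha, hb, hk, hab, s, hs, hsum⟩ := h
  have hlt : a < b := by
    have : 0 < b - a := by exact_mod_cast ht.trans_lt hab
    omega
  have hf : x ∈ driftFailure n k (b - a) s := by
    rcases hk with rfl | rfl
    · exact Or.inl ⟨by omega, by rwa [Nat.add_sub_cancel' hlt.le]⟩
    · exact Or.inr ⟨⟨by omega, hb⟩, by rwa [Nat.sub_sub_self hlt.le]⟩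
  simp only [driftFailureUnion, mem_iUnion]
  refine ⟨b - a, Finset.mem_filter.2 ⟨Finset.mem_range.2 (by omega), hab⟩, ?_⟩
  rcases hs with rfl | rfl
  · exact Or.inl hf
  · exact Or.inr hf

/-- Summation of the geometric series of failure probabilities over the block lengths `l > t`. -/
lemma IsRandomDesignModel.driftFailureUnion_le [IsProbabilityMeasure P]
    (h : IsRandomDesignModel P σ U ξ) (hσ : 0 < σ) (k : ℕ) {t : ℝ} :
    P.real {ω | (fun i => ξ i ω) ∈ driftFailureUnion n t k} ≤
      4 * Real.exp (1 / (16 * σ ^ 2)) / (1 - Real.exp (-(1 / (16 * σ ^ 2)))) *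
        Real.exp (-(1 / (16 * σ ^ 2) * t)) := by
  set γ := 1 / (16 * σ ^ 2) with hγ
  have hγ0 : 0 < γ := by positivity
  have hr1 : Real.exp (-γ) < 1 := by
    rw [Real.exp_lt_one_iff]
    linarith
  have hset : {ω | (fun i => ξ i ω) ∈ driftFailureUnion n t k} =
      ⋃ l ∈ (Finset.range (n + 1)).filter fun l : ℕ => t < l,
        ({ω | (fun i => ξ i ω) ∈ driftFailure n k l 1} ∪
          {ω | (fun i => ξ i ω) ∈ driftFailure n k l (-1)}) := by
    ext ω
    simp [driftFailureUnion]
  rw [hset]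
  refine (measureReal_biUnion_finset_le _ _).trans ?_
  have hterm : ∀ l ∈ (Finset.range (n + 1)).filter fun l : ℕ => t < l,
      P.real ({ω | (fun i => ξ i ω) ∈ driftFailure n k l 1} ∪
          {ω | (fun i => ξ i ω) ∈ driftFailure n k l (-1)}) ≤
        4 * Real.exp γ * Real.exp (-γ) ^ l := by
    intro l _
    refine (measureReal_union_le _ _).trans ?_
    linarith [h.driftFailure_le hσ k l (Or.inl rfl : (1 : ℝ) = 1 ∨ (1 : ℝ) = -1),
      h.driftFailure_le hσ k l (Or.inr rfl : (-1 : ℝ) = 1 ∨ (-1 : ℝ) = -1)]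
  refine (Finset.sum_le_sum hterm).trans ?_
  rw [← Finset.mul_sum]
  have hgeom : ∑ l ∈ (Finset.range (n + 1)).filter (fun l : ℕ => t < l), Real.exp (-γ) ^ l ≤
      Real.exp (-(γ * t)) / (1 - Real.exp (-γ)) := by
    have hsub : (Finset.range (n + 1)).filter (fun l : ℕ => t < l) ⊆
        Finset.Ico ⌈t⌉₊ (n + 1) := by
      intro l hl
      obtain ⟨h1, h2⟩ := Finset.mem_filter.1 hl
      exact Finset.mem_Ico.2 ⟨Nat.ceil_le.2 h2.le, Finset.mem_range.1 h1⟩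
    refine (Finset.sum_le_sum_of_subset_of_nonneg hsub fun _ _ _ => by positivity).trans ?_
    refine (geom_sum_Ico_le_of_lt_one (Real.exp_nonneg _) hr1).trans ?_
    have : 0 < 1 - Real.exp (-γ) := by linarith
    gcongr
    rw [← Real.exp_nat_mul, Real.exp_le_exp]
    nlinarith [Nat.le_ceil t]
  calc _ ≤ 4 * Real.exp γ * (Real.exp (-(γ * t)) / (1 - Real.exp (-γ))) := by gcongr
    _ = _ := by ring

end Noise

/-- A family of events of uniformly small probability stays so when the index is chosen by an
independent random variable with finitely many values. -/
lemma measureReal_mem_le_of_indepFun {Ω α β : Type*} [MeasurableSpace Ω] [MeasurableSpace α]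
    [MeasurableSpace β] {P : Measure Ω} [IsProbabilityMeasure P] {U : Ω → α} {ξ : Ω → β}
    (hU : AEMeasurable U P) (h : IndepFun U ξ P) {n : ℕ} {K : α → ℕ} (hK : Measurable K)
    (hKn : ∀ u, K u ≤ n) {B : ℕ → Set β} (hB : ∀ k, MeasurableSet (B k)) {c : ℝ}
    (hc : ∀ k, P.real {ω | ξ ω ∈ B k} ≤ c) : P.real {ω | ξ ω ∈ B (K (U ω))} ≤ c := by
  have hc0 : 0 ≤ c := measureReal_nonneg.trans (hc 0)
  have hsub : {ω | ξ ω ∈ B (K (U ω))} ⊆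
      ⋃ k ∈ Finset.range (n + 1), U ⁻¹' (K ⁻¹' {k}) ∩ ξ ⁻¹' B k := by
    intro ω hω
    simp only [mem_iUnion]
    exact ⟨K (U ω), Finset.mem_range.2 (Nat.lt_succ_of_le (hKn _)), rfl, hω⟩
  have hKm : ∀ k, MeasurableSet (K ⁻¹' {k}) := fun k => hK (measurableSet_singleton k)
  refine (measureReal_mono hsub (measure_ne_top _ _)).trans
    ((measureReal_biUnion_finset_le _ _).trans ?_)
  have hterm : ∀ k ∈ Finset.range (n + 1), P.real (U ⁻¹' (K ⁻¹' {k}) ∩ ξ ⁻¹' B k) ≤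
      (P.map U).real (K ⁻¹' {k}) * c := by
    intro k _
    have e : P.real (U ⁻¹' (K ⁻¹' {k}) ∩ ξ ⁻¹' B k) =
        (P.map U).real (K ⁻¹' {k}) * P.real (ξ ⁻¹' B k) := by
      rw [measureReal_def, h.measure_inter_preimage_eq_mul _ _ (hKm k) (hB k), ENNReal.toReal_mul,
        measureReal_def, measureReal_def, Measure.map_apply_of_aemeasurable hU (hKm k)]
    rw [e]
    exact mul_le_mul_of_nonneg_left (hc k) measureReal_nonneg
  refine (Finset.sum_le_sum hterm).trans ?_
  have : IsProbabilityMeasure (P.map U) := Measure.isProbabilityMeasure_map hU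
  rw [← Finset.sum_mul, sum_measureReal_preimage_singleton _ fun k _ => hKm k]
  exact mul_le_of_le_one_left hc0 measureReal_le_one

/-! ### Probability of the good event: design -/

section Design

variable {Ω : Type*} [MeasurableSpace Ω] {P : Measure Ω} {σ : ℝ} {n : ℕ} {U ξ : Fin n → Ω → ℝ}

lemma measurable_designCount {A : Set ℝ} (hA : MeasurableSet A) :
    Measurable (designCount (n := n) A) := by
  classical
  have : designCount (n := n) A = fun u => ∑ i, A.indicator (fun _ => 1) (u i) := by
    ext u
    rw [designCount, Finset.card_filter]
    simp only [indicator_apply]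
  rw [this]
  exact Finset.measurable_sum _ fun i _ =>
    (measurable_const.indicator hA).comp (measurable_pi_apply i)

lemma IsRandomDesignModel.aemeasurable_design (h : IsRandomDesignModel P σ U ξ) (i : Fin n) :
    AEMeasurable (U i) P :=
  (h.design_uniform i).aemeasurable (by simp) (by simp)

lemma IsRandomDesignModel.ae_mem_Icc (h : IsRandomDesignModel P σ U ξ) :
    ∀ᵐ ω ∂P, ∀ i, U i ω ∈ Icc (0 : ℝ) 1 := by
  rw [ae_all_iff]
  intro i
  refine ae_of_ae_map (h.aemeasurable_design i) ?_
  have e : P.map (U i) = ProbabilityTheory.cond volume (Icc (0 : ℝ) 1) := h.design_uniform i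
  rw [e]
  exact ae_cond_mem measurableSet_Icc

lemma IsRandomDesignModel.map_design_real_Ioo (h : IsRandomDesignModel P σ U ξ) (i : Fin n)
    {c d : ℝ} (h0 : 0 ≤ c) (hcd : c ≤ d) (h1 : d ≤ 1) :
    (P.map (U i)).real (Ioo c d) = d - c := by
  have e : P.map (U i) = ProbabilityTheory.cond volume (Icc (0 : ℝ) 1) := h.design_uniform i
  rw [e, measureReal_def, cond_apply measurableSet_Icc,
    inter_eq_right.2 (Ioo_subset_Icc_self.trans (Icc_subset_Icc h0 h1))]
  simp [hcd]

/-- Chernoff's bound for the lower tail of the number of design points in an interval. -/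
lemma IsRandomDesignModel.designCount_le_quarter [IsProbabilityMeasure P]
    (h : IsRandomDesignModel P σ U ξ) {c d : ℝ} (h0 : 0 ≤ c) (hcd : c ≤ d) (h1 : d ≤ 1) :
    P.real {ω | (designCount (Ioo c d) (fun i => U i ω) : ℝ) ≤ n * (d - c) / 4} ≤
      Real.exp (-(n * (d - c) / 4)) := by
  classical
  set A := Ioo c d with hA
  set V : Fin n → Ω → ℝ := fun i ω => A.indicator (fun _ => (1 : ℝ)) (U i ω) with hV
  have hm : Measurable (A.indicator fun _ => (1 : ℝ)) :=
    measurable_const.indicator measurableSet_Ioo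
  have hVm : ∀ i, AEMeasurable (V i) P := fun i => hm.comp_aemeasurable (h.aemeasurable_design i)
  have hVind : iIndepFun V P := h.design_indep.comp (fun _ => A.indicator fun _ => 1) fun _ => hm
  have hcount : ∀ ω, (designCount A (fun i => U i ω) : ℝ) = (∑ i, V i) ω := by
    intro ω
    rw [designCount, Finset.card_filter, Finset.sum_apply]
    push_cast
    simp only [hV, indicator_apply]
  have hmgf : ∀ i, mgf (V i) P (-1) ≤ Real.exp (-((d - c) / 2)) := by
    intro i
    have hf : ∀ u : ℝ, Real.exp (-1 * A.indicator (fun _ => (1 : ℝ)) u) =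
        1 + A.indicator (fun _ => Real.exp (-1) - 1) u := by
      intro u
      by_cases hu : u ∈ A <;> simp [hu]
    have e : mgf (V i) P (-1) = 1 + (d - c) * (Real.exp (-1) - 1) := by
      have : IsProbabilityMeasure (P.map (U i)) :=
        Measure.isProbabilityMeasure_map (h.aemeasurable_design i)
      rw [mgf, ← h.map_design_real_Ioo i h0 hcd h1]
      simp only [hV, hf]
      rw [← integral_map (h.aemeasurable_design i)
        (f := fun u => 1 + A.indicator (fun _ => Real.exp (-1) - 1) u)
        (measurable_const.add (measurable_const.indicator measurableSet_Ioo)).aestronglyMeasurable,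
        integral_add (integrable_const _) ((integrable_const _).indicator measurableSet_Ioo),
        integral_indicator_const _ measurableSet_Ioo]
      simp
    rw [e]
    have := Real.add_one_le_exp (-((d - c) / 2))
    nlinarith [Real.exp_neg_one_lt_half]
  have hint : Integrable (fun ω => Real.exp (-1 * (∑ i, V i) ω)) P := by
    refine Integrable.of_bound (C := 1) ?_ (ae_of_all _ fun ω => ?_)
    · have : AEMeasurable (∑ i, V i) P := Finset.aemeasurable_sum _ fun i _ => hVm i
      exact (Real.measurable_exp.comp_aemeasurable (this.const_mul _)).aestronglyMeasurable
    · rw [Real.norm_eq_abs, Real.abs_exp, Real.exp_le_one_iff, ← hcount]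
      have : (0 : ℝ) ≤ designCount A (fun i => U i ω) := Nat.cast_nonneg _
      linarith
  simp only [hcount]
  -- the exponent `-1` in Chernoff's bound suffices, as `1 - exp (-1) ≥ 1 / 2`
  refine (measure_le_le_exp_mul_mgf _ (by norm_num) hint).trans ?_
  rw [hVind.mgf_sum₀ hVm]
  calc _ ≤ Real.exp (-(-1) * (n * (d - c) / 4)) * ∏ _i : Fin n, Real.exp (-((d - c) / 2)) := by
        gcongr with i _
        · exact fun i _ => mgf_nonneg
        · exact hmgf i
    _ = _ := by
        rw [Finset.prod_const, Finset.card_univ, Fintype.card_fin, ← Real.exp_nat_mul,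
          ← Real.exp_add]
        congr 1
        ring

lemma IsRandomDesignModel.wellSpread_compl_le [IsProbabilityMeasure P]
    (h : IsRandomDesignModel P σ U ξ) {g t : ℝ} (hg : g ∈ Icc (0 : ℝ) 1) (ht : 0 ≤ t) :
    P.real {ω | ¬WellSpread (reorder fun i => U i ω) g t} ≤ 2 * Real.exp (-(n * t / 4)) := by
  have hside : ∀ (q : Prop) (c d : ℝ), d - c = t → (q → 0 ≤ c ∧ d ≤ 1) →
      P.real {ω | q ∧ (designCount (Ioo c d) (fun i => U i ω) : ℝ) ≤ n * t / 4} ≤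
        Real.exp (-(n * t / 4)) := by
    intro q c d hcd hq
    by_cases hq' : q
    · have := h.designCount_le_quarter (hq hq').1 (by linarith) (hq hq').2
      rw [hcd] at this
      simpa [hq'] using this
    · simp [hq', Real.exp_nonneg]
  have h1 := hside (0 ≤ g - t) (g - t) g (by ring) fun hq => ⟨hq, hg.2⟩
  have h2 := hside (g + t ≤ 1) g (g + t) (by ring) fun hq => ⟨hg.1, hq⟩
  have hsub : {ω | ¬WellSpread (reorder fun i => U i ω) g t} ⊆
      {ω | 0 ≤ g - t ∧ (designCount (Ioo (g - t) g) (fun i => U i ω) : ℝ) ≤ n * t / 4} ∪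
      {ω | g + t ≤ 1 ∧ (designCount (Ioo g (g + t)) (fun i => U i ω) : ℝ) ≤ n * t / 4} := by
    intro ω hω
    simp only [WellSpread, mem_ofPred_eq, designCount_reorder] at hω
    by_contra! hc
    simp only [mem_union, mem_ofPred_eq, not_or, not_and, not_le] at hc
    exact hω ⟨hc.1, hc.2⟩
  refine (measureReal_mono hsub (measure_ne_top _ _)).trans ((measureReal_union_le _ _).trans ?_)
  linarith

lemma IsRandomDesignModel.driftDominates_compl_le [IsProbabilityMeasure P]
    (h : IsRandomDesignModel P σ U ξ) (hσ : 0 < σ) {A : Set ℝ} (hA : MeasurableSet A) {t : ℝ}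
    (ht : 0 ≤ t) :
    P.real {ω | ¬DriftDominates (fun i => ξ i ω)
        (designCount A (reorder fun i => U i ω)) t} ≤
      4 * Real.exp (1 / (16 * σ ^ 2)) / (1 - Real.exp (-(1 / (16 * σ ^ 2)))) *
        Real.exp (-(1 / (16 * σ ^ 2) * t)) := by
  refine le_trans (measureReal_mono ?_) (measureReal_mem_le_of_indepFun
    (aemeasurable_pi_lambda _ h.aemeasurable_design) h.design_indep_noise
    (measurable_designCount hA) (designCount_le A) (measurableSet_driftFailureUnion n t)
    fun k => h.driftFailureUnion_le hσ k)
  intro ω hω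
  simp only [mem_ofPred_eq, designCount_reorder] at hω
  exact mem_driftFailureUnion_of_not ht hω

end Design

/-! ### The deviation inequality -/

section Deviation

variable {Ω : Type*} [MeasurableSpace Ω] {P : Measure Ω} {σ : ℝ} {n : ℕ} {U ξ : Fin n → Ω → ℝ}
  {T : (Fin n → ℝ) → (Fin n → ℝ) → Set ℝ} {G : Set ℝ}

lemma loss_lt_of_good {u x : Fin n → ℝ} (hT : IsTwoStepEstimator T) (hu : ∀ i, u i ∈ Icc 0 1)
    {g₁ g₂ h h' : ℝ} (h0 : 0 ≤ g₁) (h1 : g₂ ≤ 1) (hh : 0 < h)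
    (hh' : 0 < h') (hlen : g₁ + 8 * h ≤ g₂) (hn : 8 ≤ n * h)
    (hw₁ : WellSpread (reorder u) g₁ h) (hw₂ : WellSpread (reorder u) g₂ h)
    (hw₁' : WellSpread (reorder u) g₁ h') (hw₂' : WellSpread (reorder u) g₂ h')
    (hx : EvenNoiseSmall x (n * h / 64))
    (hx₁ : DriftDominates x (designCount (Iio g₁) (reorder u)) (n * h' / 4))
    (hx₂ : DriftDominates x (designCount (Iic g₂) (reorder u)) (n * h' / 4)) :
    loss T (Icc g₁ g₂) u x < 2 * h' :=
  nikodymDist_lt_of_isTwoStepEstimate (Tuple.monotone_sort u) (fun _ => hu _) h0 h1 hh hh' hlen hn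
    hw₁ hw₂ hw₁' hw₂' hx hx₁ hx₂ (hT _ _ (Tuple.monotone_sort u))

/-- The union bound over the parts of the good event, at the fixed scale `t` for the first step and
the scale `t'` for the second. -/
lemma IsRandomDesignModel.loss_tail_of_large [IsProbabilityMeasure P]
    (h : IsRandomDesignModel P σ U ξ) (hσ : 0 < σ) (hT : IsTwoStepEstimator T)
    {g₁ g₂ t t' : ℝ} (h0 : 0 ≤ g₁) (h1 : g₂ ≤ 1) (ht : 0 < t) (ht' : 0 < t')
    (hlen : g₁ + 8 * t ≤ g₂) (hn : 8 ≤ n * t) :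
    P.real {ω | 2 * t' ≤ loss T (Icc g₁ g₂) (fun i => U i ω) (fun i => ξ i ω)} ≤
      4 * Real.exp (-(n * t / 4)) + 4 * Real.exp (-(n * t' / 4)) +
        2 * (n + 1) ^ 2 * Real.exp (-(n * t / 64) ^ 2 / (2 * (n * σ ^ 2))) +
        2 * (4 * Real.exp (1 / (16 * σ ^ 2)) / (1 - Real.exp (-(1 / (16 * σ ^ 2)))) *
          Real.exp (-(1 / (16 * σ ^ 2) * (n * t' / 4)))) := by
  have hg₁ : g₁ ∈ Icc (0 : ℝ) 1 := ⟨h0, by linarith⟩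
  have hg₂ : g₂ ∈ Icc (0 : ℝ) 1 := ⟨by linarith, h1⟩
  have hU : P.real {ω | ¬∀ i, U i ω ∈ Icc (0 : ℝ) 1} = 0 := by
    rw [measureReal_def, ae_iff.1 h.ae_mem_Icc, ENNReal.toReal_zero]
  have hsub : {ω | 2 * t' ≤ loss T (Icc g₁ g₂) (fun i => U i ω) (fun i => ξ i ω)} ⊆
      {ω | ¬∀ i, U i ω ∈ Icc (0 : ℝ) 1} ∪
      ({ω | ¬WellSpread (reorder fun i => U i ω) g₁ t} ∪
      ({ω | ¬WellSpread (reorder fun i => U i ω) g₂ t} ∪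
      ({ω | ¬WellSpread (reorder fun i => U i ω) g₁ t'} ∪
      ({ω | ¬WellSpread (reorder fun i => U i ω) g₂ t'} ∪
      ({ω | ¬EvenNoiseSmall (fun i => ξ i ω) (n * t / 64)} ∪
      ({ω | ¬DriftDominates (fun i => ξ i ω)
          (designCount (Iio g₁) (reorder fun i => U i ω)) (n * t' / 4)} ∪
      {ω | ¬DriftDominates (fun i => ξ i ω)
          (designCount (Iic g₂) (reorder fun i => U i ω)) (n * t' / 4)})))))) := by
    intro ω hω
    by_contra hc
    simp only [mem_union, mem_ofPred_eq, not_or, not_not] at hc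
    obtain ⟨hu, hw₁, hw₂, hw₁', hw₂', hx, hx₁, hx₂⟩ := hc
    exact absurd (loss_lt_of_good hT hu h0 h1 ht ht' hlen hn hw₁ hw₂ hw₁' hw₂' hx hx₁ hx₂)
      (not_lt.2 hω)
  have hnt : 0 ≤ n * t' / 4 := by positivity
  have hu := measureReal_mono hsub (measure_ne_top P _)
  have b1 := h.wellSpread_compl_le hg₁ ht.le
  have b2 := h.wellSpread_compl_le hg₂ ht.le
  have b3 := h.wellSpread_compl_le hg₁ ht'.le
  have b4 := h.wellSpread_compl_le hg₂ ht'.le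
  have b5 := h.evenNoiseSmall_compl_le hσ (δ := n * t / 64) (by linarith)
  have b6 := h.driftDominates_compl_le hσ (measurableSet_Iio (a := g₁)) hnt
  have b7 := h.driftDominates_compl_le hσ (measurableSet_Iic (a := g₂)) hnt
  refine hu.trans ?_
  refine (measureReal_union_le _ _).trans ((add_le_add hU.le ((measureReal_union_le _ _).trans
    (add_le_add b1 ((measureReal_union_le _ _).trans (add_le_add b2
    ((measureReal_union_le _ _).trans (add_le_add b3 ((measureReal_union_le _ _).trans
    (add_le_add b4 ((measureReal_union_le _ _).trans (add_le_add b5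
    ((measureReal_union_le _ _).trans (add_le_add b6 b7))))))))))))).trans_eq ?_)
  ring

lemma exists_eq_Icc_of_mem_longSegments {μ : ℝ} (hG : G ∈ longSegments μ) :
    ∃ g₁ g₂ : ℝ, 0 ≤ g₁ ∧ g₂ ≤ 1 ∧ g₁ + μ ≤ g₂ ∧ G = Icc g₁ g₂ := by
  obtain ⟨⟨a, b, ha, hab, hb, rfl⟩, hμ⟩ := hG
  rw [Real.volume_real_Icc_of_le hab] at hμ
  exact ⟨a, b, ha, hb, by linarith, rfl⟩

end Deviation

/-- The deviation inequality with an exponential tail, which is stronger than the tail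
`exp (-c √x)`. -/
lemma exists_loss_tail (σ μ : ℝ) (hσ : 0 < σ) (hμ : 0 < μ) :
    ∃ c₂ c₃ c₄ c₅ : ℝ, 0 < c₂ ∧ 0 < c₃ ∧ 0 < c₄ ∧ 0 < c₅ ∧
      ∀ (n : ℕ), 1 ≤ n →
      ∀ (Ω : Type u) [MeasurableSpace Ω] (P : Measure Ω) [IsProbabilityMeasure P]
        (U ξ : Fin n → Ω → ℝ), IsRandomDesignModel P σ U ξ →
      ∀ T : (Fin n → ℝ) → (Fin n → ℝ) → Set ℝ, IsTwoStepEstimator T →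
      ∀ G ∈ longSegments μ, ∀ x : ℝ, 0 ≤ x →
        P.real {ω | (x + 1) / n ≤ loss T G (fun i => U i ω) (fun i => ξ i ω)} ≤
          c₂ * (n : ℝ) ^ 4 * Real.exp (-(c₃ * n)) + c₄ * Real.exp (-(c₅ * (x + 1))) := by
  set γ := 1 / (16 * σ ^ 2) with hγ
  have hγ0 : 0 < γ := by positivity
  have hr1 : 0 < 1 - Real.exp (-γ) := by
    have : Real.exp (-γ) < 1 := Real.exp_lt_one_iff.2 (by linarith)
    linarith
  set C := 4 * Real.exp γ / (1 - Real.exp (-γ)) with hC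
  have hC0 : 0 < C := by positivity
  set c₃ := min (μ / 32) ((μ / 512) ^ 2 / (2 * σ ^ 2)) with hc₃
  have hc₃0 : 0 < c₃ := by positivity
  set c₅ := min 1 γ / 8 with hc₅
  have hc₅0 : 0 < c₅ := by positivity
  refine ⟨12 + Real.exp (c₃ * (64 / μ)), c₃, 4 + 2 * C, c₅, by positivity, hc₃0, by positivity,
    hc₅0, ?_⟩
  intro n hn Ω _ P _ U ξ h T hT G hG x hx
  have hn1 : (1 : ℝ) ≤ n := by exact_mod_cast hn
  have hn4 : (1 : ℝ) ≤ (n : ℝ) ^ 4 := one_le_pow₀ hn1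
  rcases lt_or_ge (n * μ) 64 with hsmall | hlarge
  · -- for small `n` the right-hand side is at least `1`
    refine measureReal_le_one.trans ?_
    have h1 : 1 ≤ Real.exp (c₃ * (64 / μ)) * Real.exp (-(c₃ * n)) := by
      rw [← Real.exp_add, Real.one_le_exp_iff]
      have : (n : ℝ) ≤ 64 / μ := by
        rw [le_div_iff₀ hμ]
        exact hsmall.le
      nlinarith
    have h2 : Real.exp (c₃ * (64 / μ)) * Real.exp (-(c₃ * n)) ≤
        (12 + Real.exp (c₃ * (64 / μ))) * (n : ℝ) ^ 4 * Real.exp (-(c₃ * n)) := by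
      refine mul_le_mul_of_nonneg_right ?_ (Real.exp_nonneg _)
      nlinarith [Real.exp_pos (c₃ * (64 / μ))]
    have h3 : 0 ≤ (4 + 2 * C) * Real.exp (-(c₅ * (x + 1))) := by positivity
    linarith
  · obtain ⟨g₁, g₂, h0, h1, hlen, rfl⟩ := exists_eq_Icc_of_mem_longSegments hG
    have hn0 : (0 : ℝ) < n := by linarith
    have key := h.loss_tail_of_large hσ hT h0 h1 (t := μ / 8) (t' := (x + 1) / 2 / n)
      (by positivity) (by positivity) (by linarith) (by linarith)
    have e1 : 2 * ((x + 1) / 2 / n) = (x + 1) / n := by ring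
    have e2 : n * ((x + 1) / 2 / n) / 4 = (x + 1) / 8 := by
      field_simp
      norm_num
    rw [e1, e2, ← hγ, ← hC] at key
    have b1 : Real.exp (-(n * (μ / 8) / 4)) ≤ (n : ℝ) ^ 4 * Real.exp (-(c₃ * n)) := by
      have : Real.exp (-(n * (μ / 8) / 4)) ≤ Real.exp (-(c₃ * n)) := by
        rw [Real.exp_le_exp]
        nlinarith [min_le_left (μ / 32) ((μ / 512) ^ 2 / (2 * σ ^ 2))]
      nlinarith [Real.exp_pos (-(c₃ * n))]
    have b2 : ((n : ℝ) + 1) ^ 2 * Real.exp (-(n * (μ / 8) / 64) ^ 2 / (2 * (n * σ ^ 2))) ≤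
        4 * (n : ℝ) ^ 4 * Real.exp (-(c₃ * n)) := by
      have hsq : ((n : ℝ) + 1) ^ 2 ≤ 4 * (n : ℝ) ^ 4 := by
        have hn2 : (n : ℝ) ^ 2 ≤ (n : ℝ) ^ 4 := pow_le_pow_right₀ hn1 (by norm_num)
        nlinarith
      gcongr
      have e : -(n * (μ / 8) / 64) ^ 2 / (2 * (n * σ ^ 2)) =
          -((μ / 512) ^ 2 / (2 * σ ^ 2) * n) := by
        field_simp
        ring
      rw [e]
      nlinarith [min_le_right (μ / 32) ((μ / 512) ^ 2 / (2 * σ ^ 2))]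
    have b3 : Real.exp (-((x + 1) / 8)) ≤ Real.exp (-(c₅ * (x + 1))) := by
      rw [Real.exp_le_exp]
      nlinarith [min_le_left 1 γ]
    have b4 : Real.exp (-(γ * ((x + 1) / 8))) ≤ Real.exp (-(c₅ * (x + 1))) := by
      rw [Real.exp_le_exp]
      nlinarith [min_le_right 1 γ]
    have b5 := mul_le_mul_of_nonneg_left b4 hC0.le
    have b6 : 0 ≤ Real.exp (c₃ * (64 / μ)) * ((n : ℝ) ^ 4 * Real.exp (-(c₃ * n))) := by positivity
    refine key.trans ?_
    linarith

/-! ### From the tail to the moments -/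

/-- `∫ L ^ q` is controlled by the tails of `L` on the grid of step `1 / n`. As `L` need not be
measurable, the integral is a lower one and the probabilities are outer measures. -/
lemma lintegral_rpow_le_of_tail {Ω : Type*} [MeasurableSpace Ω] {P : Measure Ω}
    [IsProbabilityMeasure P] {n : ℕ} (hn : 1 ≤ n) {L : Ω → ℝ} (hL0 : ∀ ω, 0 ≤ L ω)
    (hL1 : ∀ᵐ ω ∂P, L ω ≤ 1) {q : ℝ} (hq : 0 < q) {p : ℕ → ℝ}
    (hp : ∀ k : ℕ, P.real {ω | ((k : ℝ) + 1) / n ≤ L ω} ≤ p k) :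
    ∫⁻ ω, ENNReal.ofReal (L ω ^ q) ∂P ≤
      ENNReal.ofReal ((1 + ∑ k ∈ Finset.range n, ((k : ℝ) + 2) ^ q * p k) / (n : ℝ) ^ q) := by
  have hn0 : (0 : ℝ) < n := by exact_mod_cast hn
  have hp0 : ∀ k, 0 ≤ p k := fun k => measureReal_nonneg.trans (hp k)
  set A : ℕ → Set Ω := fun k => toMeasurable P {ω | ((k : ℝ) + 1) / n ≤ L ω} with hA
  have hAm : ∀ k, MeasurableSet (A k) := fun k => measurableSet_toMeasurable _ _
  have hAP : ∀ k, P (A k) ≤ ENNReal.ofReal (p k) := by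
    intro k
    rw [hA, measure_toMeasurable, ← ofReal_measureReal]
    exact ENNReal.ofReal_le_ofReal (hp k)
  have hpt : ∀ᵐ ω ∂P, ENNReal.ofReal (L ω ^ q) ≤ ENNReal.ofReal ((1 / (n : ℝ)) ^ q) +
      ∑ k ∈ Finset.range n,
        (A k).indicator (fun _ => ENNReal.ofReal ((((k : ℝ) + 2) / n) ^ q)) ω := by
    filter_upwards [hL1] with ω h1
    rcases lt_or_ge (L ω) (1 / n) with h | h
    · refine le_add_right (ENNReal.ofReal_le_ofReal ?_)
      exact Real.rpow_le_rpow (hL0 ω) h.le hq.le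
    · have hnL : 1 ≤ n * L ω := by
        rwa [div_le_iff₀ hn0, mul_comm] at h
      obtain ⟨k, hk⟩ : ∃ k, ⌊n * L ω⌋₊ = k + 1 :=
        Nat.exists_eq_succ_of_ne_zero (Nat.floor_pos.2 hnL).ne'
      have hk1 : (k : ℝ) + 1 ≤ n * L ω := by
        have := Nat.floor_le (show 0 ≤ n * L ω by linarith)
        rw [hk] at this
        exact_mod_cast this
      have hk2 : n * L ω < (k : ℝ) + 2 := by
        have := Nat.lt_floor_add_one (n * L ω)
        rw [hk] at this
        push_cast at this
        linarith
      have hkn : k < n := by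
        have : (k : ℝ) + 1 ≤ n := hk1.trans (mul_le_of_le_one_right hn0.le h1)
        exact_mod_cast this
      have hmem : ω ∈ A k := subset_toMeasurable P _ (by
        change ((k : ℝ) + 1) / n ≤ L ω
        rw [div_le_iff₀ hn0]
        linarith)
      refine le_add_left (le_trans ?_ (Finset.single_le_sum
        (f := fun k => (A k).indicator (fun _ => ENNReal.ofReal ((((k : ℝ) + 2) / n) ^ q)) ω)
        (fun _ _ => zero_le) (Finset.mem_range.2 hkn)))
      simp only [indicator_of_mem hmem]
      refine ENNReal.ofReal_le_ofReal (Real.rpow_le_rpow (hL0 ω) ?_ hq.le)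
      rw [le_div_iff₀ hn0]
      linarith
  refine (lintegral_mono_ae hpt).trans ?_
  rw [lintegral_add_left measurable_const, lintegral_const, measure_univ, mul_one,
    lintegral_finsetSum _ fun k _ => measurable_const.indicator (hAm k)]
  simp only [lintegral_indicator_const (hAm _)]
  calc _ ≤ ENNReal.ofReal ((1 / (n : ℝ)) ^ q) +
        ∑ k ∈ Finset.range n, ENNReal.ofReal ((((k : ℝ) + 2) / n) ^ q * p k) := by
        gcongr with k _
        rw [ENNReal.ofReal_mul (by positivity)]
        gcongr
        exact hAP k
    _ = _ := by
        have hk0 : ∀ k ∈ Finset.range n, 0 ≤ (((k : ℝ) + 2) / n) ^ q * p k := fun k _ =>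
          mul_nonneg (by positivity) (hp0 k)
        rw [← ENNReal.ofReal_sum_of_nonneg hk0,
          ← ENNReal.ofReal_add (by positivity) (Finset.sum_nonneg hk0)]
        congr 1
        rw [add_div, Finset.sum_div, Real.div_rpow zero_le_one hn0.le, Real.one_rpow]
        congr 1
        refine Finset.sum_congr rfl fun k _ => ?_
        rw [Real.div_rpow (by positivity) hn0.le]
        ring

lemma exists_add_two_rpow_le_exp (p : ℝ) {c : ℝ} (hc : 0 < c) :
    ∃ C : ℝ, 0 < C ∧ ∀ x : ℝ, 0 ≤ x → (x + 2) ^ p ≤ C * Real.exp (c * x) := by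
  refine ⟨(⌈p⌉₊.factorial : ℝ) / c ^ ⌈p⌉₊ * Real.exp (c * 2), by positivity, fun x hx => ?_⟩
  have h1 : (x + 2) ^ p ≤ (x + 2) ^ ⌈p⌉₊ := by
    rw [← Real.rpow_natCast]
    exact Real.rpow_le_rpow_of_exponent_le (by linarith) (Nat.le_ceil p)
  have h2 := Real.pow_div_factorial_le_exp (c * (x + 2)) (by positivity) ⌈p⌉₊
  rw [mul_pow, div_le_iff₀ (by positivity)] at h2
  refine h1.trans ?_
  rw [mul_assoc, ← Real.exp_add, div_mul_eq_mul_div, le_div_iff₀ (by positivity),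
    show c * 2 + c * x = c * (x + 2) by ring]
  linarith

/-- The sum that bounds the moment of order `q` is bounded in `n`. -/
lemma exists_sum_tail_le {q c₂ c₃ c₄ c₅ : ℝ} (hq : 0 < q) (hc₂ : 0 < c₂) (hc₃ : 0 < c₃)
    (hc₄ : 0 < c₄) (hc₅ : 0 < c₅) :
    ∃ B : ℝ, 0 < B ∧ ∀ n : ℕ, ∑ k ∈ Finset.range n, ((k : ℝ) + 2) ^ q *
      (c₂ * (n : ℝ) ^ 4 * Real.exp (-(c₃ * n)) + c₄ * Real.exp (-(c₅ * (k + 1)))) ≤ B := by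
  obtain ⟨C, hC, hCb⟩ := exists_add_two_rpow_le_exp (q + 5) hc₃
  obtain ⟨D, hD, hDb⟩ := exists_add_two_rpow_le_exp q (half_pos hc₅)
  have hr1 : Real.exp (-(c₅ / 2)) < 1 := Real.exp_lt_one_iff.2 (by linarith)
  have hr : 0 < 1 - Real.exp (-(c₅ / 2)) := by linarith
  refine ⟨c₂ * C + c₄ * D * (1 / (1 - Real.exp (-(c₅ / 2)))), by positivity, fun n => ?_⟩
  refine ((Finset.sum_congr rfl fun k _ => mul_add _ _ _).trans
    Finset.sum_add_distrib).trans_le (add_le_add ?_ ?_)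
  · have h1 : ∀ k ∈ Finset.range n, ((k : ℝ) + 2) ^ q * (c₂ * (n : ℝ) ^ 4 * Real.exp (-(c₃ * n)))
        ≤ ((n : ℝ) + 2) ^ q * (c₂ * (n : ℝ) ^ 4 * Real.exp (-(c₃ * n))) := by
      intro k hk
      have : (k : ℝ) ≤ n := by exact_mod_cast (Finset.mem_range.1 hk).le
      gcongr
    refine (Finset.sum_le_sum h1).trans ?_
    rw [Finset.sum_const, Finset.card_range, nsmul_eq_mul]
    have h2 : ((n : ℝ) + 2) ^ q * (n : ℝ) ^ 5 ≤ C * Real.exp (c₃ * n) := by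
      refine le_trans ?_ (hCb n (Nat.cast_nonneg n))
      rw [Real.rpow_add (by positivity)]
      gcongr
      have : ((n : ℝ) + 2) ^ (5 : ℝ) = ((n : ℝ) + 2) ^ 5 := by
        rw [← Real.rpow_natCast, Nat.cast_ofNat]
      rw [this]
      gcongr
      linarith
    calc _ = c₂ * ((((n : ℝ) + 2) ^ q * (n : ℝ) ^ 5) * Real.exp (-(c₃ * n))) := by ring
      _ ≤ c₂ * ((C * Real.exp (c₃ * n)) * Real.exp (-(c₃ * n))) := by gcongr
      _ = c₂ * C := by rw [mul_assoc C, ← Real.exp_add, add_neg_cancel, Real.exp_zero, mul_one]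
  · have h1 : ∀ k ∈ Finset.range n, ((k : ℝ) + 2) ^ q * (c₄ * Real.exp (-(c₅ * (k + 1)))) ≤
        c₄ * D * Real.exp (-(c₅ / 2)) ^ k := by
      intro k _
      calc ((k : ℝ) + 2) ^ q * (c₄ * Real.exp (-(c₅ * (k + 1))))
          ≤ D * Real.exp (c₅ / 2 * k) * (c₄ * Real.exp (-(c₅ * k))) := by
            gcongr
            · exact hDb k (Nat.cast_nonneg k)
            · linarith
        _ = c₄ * D * (Real.exp (c₅ / 2 * k) * Real.exp (-(c₅ * k))) := by ring
        _ = _ := by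
            rw [← Real.exp_add, ← Real.exp_nat_mul]
            congr 2
            ring
    refine (Finset.sum_le_sum h1).trans ?_
    rw [← Finset.mul_sum]
    gcongr
    have := geom_sum_Ico_le_of_lt_one (m := 0) (n := n) (Real.exp_nonneg (-(c₅ / 2))) hr1
    rwa [← Finset.range_eq_Ico, pow_zero] at this

lemma loss_le_one {n : ℕ} {T : (Fin n → ℝ) → (Fin n → ℝ) → Set ℝ} (hT : IsTwoStepEstimator T)
    {G : Set ℝ} (hG : G ∈ segments) {u x : Fin n → ℝ} (hu : ∀ i, u i ∈ Icc (0 : ℝ) 1) :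
    loss T G u x ≤ 1 := by
  obtain ⟨a, b, ha, -, hb, rfl⟩ := hG
  obtain ⟨_, _, _, _, l, r, _, _, he⟩ := hT (reorder u) (labels (Icc a b) (reorder u) x)
    (Tuple.monotone_sort u)
  rw [loss, he, nikodymDist]
  have hsub : symmDiff (Icc (reorder u l) (reorder u r)) (Icc a b) ⊆ Icc 0 1 := by
    refine (symmDiff_le_sup (a := Icc (reorder u l) (reorder u r)) (b := Icc a b)).trans ?_
    exact union_subset (Icc_subset_Icc (hu _).1 (hu _).2) (Icc_subset_Icc ha hb)
  refine (measureReal_mono hsub (by simp)).trans_eq ?_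
  simp

end SegmentRegression

theorem theorem9 (σ μ : ℝ) (hσ : 0 < σ) (hμ : μ ∈ Set.Ioo (0 : ℝ) 1) :
    (∃ c₁ c₂ c₃ c₄ c₅ : ℝ, 0 < c₁ ∧ 0 < c₂ ∧ 0 < c₃ ∧ 0 < c₄ ∧ 0 < c₅ ∧
      ∀ (n : ℕ), 1 ≤ n →
      ∀ (Ω : Type u) [MeasurableSpace Ω] (P : Measure Ω) [IsProbabilityMeasure P]
        (U ξ : Fin n → Ω → ℝ), SegmentRegression.IsRandomDesignModel P σ U ξ →
      ∀ T : (Fin n → ℝ) → (Fin n → ℝ) → Set ℝ, SegmentRegression.IsTwoStepEstimator T →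
      ∀ x : ℝ, 0 ≤ x →
        (⨆ G ∈ SegmentRegression.longSegments μ,
            P {ω | (x + c₁) / n ≤
              SegmentRegression.loss T G (fun i => U i ω) (fun i => ξ i ω)}) ≤
          ENNReal.ofReal
            (c₂ * (n : ℝ) ^ 4 * Real.exp (-(c₃ * n)) + c₄ * Real.exp (-(c₅ * √x)))) ∧
    (∀ q : ℝ, 0 < q → ∃ B : ℝ, 0 < B ∧
      ∀ (n : ℕ), 1 ≤ n →
      ∀ (Ω : Type u) [MeasurableSpace Ω] (P : Measure Ω) [IsProbabilityMeasure P]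
        (U ξ : Fin n → Ω → ℝ), SegmentRegression.IsRandomDesignModel P σ U ξ →
      ∀ T : (Fin n → ℝ) → (Fin n → ℝ) → Set ℝ, SegmentRegression.IsTwoStepEstimator T →
        (⨆ G ∈ SegmentRegression.longSegments μ,
            ∫⁻ ω, ENNReal.ofReal
              (SegmentRegression.loss T G (fun i => U i ω) (fun i => ξ i ω) ^ q) ∂P) ≤
          ENNReal.ofReal (B / (n : ℝ) ^ q)) := by
  obtain ⟨c₂, c₃, c₄, c₅, hc₂, hc₃, hc₄, hc₅, htail⟩ :=
    SegmentRegression.exists_loss_tail.{u} σ μ hσ hμ.1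
  constructor
  · refine ⟨1, c₂, c₃, c₄, c₅, one_pos, hc₂, hc₃, hc₄, hc₅, ?_⟩
    intro n hn Ω _ P _ U ξ h T hT x hx
    refine iSup₂_le fun G hG => ?_
    rw [← ofReal_measureReal]
    refine ENNReal.ofReal_le_ofReal ((htail n hn Ω P U ξ h T hT G hG x hx).trans ?_)
    -- the exponential tail in `x + 1` is smaller than the required one in `√x`
    have hsqrt : √x ≤ x + 1 := by nlinarith [Real.sq_sqrt hx, sq_nonneg (√x - 1)]
    gcongr
  · intro q hq
    obtain ⟨B, hB, hsum⟩ := SegmentRegression.exists_sum_tail_le hq hc₂ hc₃ hc₄ hc₅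
    refine ⟨1 + B, by positivity, ?_⟩
    intro n hn Ω _ P _ U ξ h T hT
    refine iSup₂_le fun G hG => ?_
    refine (SegmentRegression.lintegral_rpow_le_of_tail hn (fun ω => measureReal_nonneg) ?_ hq
      fun k => htail n hn Ω P U ξ h T hT G hG k (Nat.cast_nonneg k)).trans ?_
    · filter_upwards [h.ae_mem_Icc] with ω hω
      exact SegmentRegression.loss_le_one hT hG.1 hω
    · refine ENNReal.ofReal_le_ofReal ?_
      gcongr
      exact hsum n
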